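/- Let $c_1,\dots,c_l$ be pairwise distinct points (sites) of $\mathbb{R}^n$ carrying nonzero real charges $\zeta_1,\dots,\zeta_l$, all of the same sign. For $\alpha>0$ put $$V_\alpha(x)=\sum_{i=1}^l \frac{\zeta_i}{\rho_i(x)^\alpha},\qquad \rho_i(x)=\|x-c_i\|^2,\qquad x\in\mathbb{R}^n\setminus\{c_1,\dots,c_l\}.$$ A Voronoi cell $S$ is a nonempty set consisting of all points having exactly the same set $\mathcal{NS}(S)$ of nearest sites; its dimension is that of its affine span. The boundary of a convex set below means its relative boundary. For a nonempty affine subspace $L\subset\mathbb{R}^n$ let $\pi_L$ be the orthogonal projection onto $L$. The cell $S$ is called effective if it meets the convex hull of $\mathcal{NS}(S)$, and effective with respect to $L$ if it meets the convex hull of $\pi_L(\mathcal{NS}(S))$. The configuration is generic if every Voronoi cell $S$, of any codimension $k$, has exactly $k+1$ nearest sites and does not meet the boundary of the convex hull of $\mathcal{NS}(S)$. The subspace $L$ intersects the Voronoi diagram generically if every Voronoi cell $S$ that meets $L$ is transversal to $L$, has exactly $k+1$ nearest sites, where $k$ is its codimension in $\mathbb{R}^n$, and does not meet the boundary of the convex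 hull of $\pi_L(\mathcal{NS}(S))$. The Morse index of a critical point is the largest dimension of a subspace on which the Hessian is negative definite. **(a)** If the configuration is generic, then there is $\alpha_0>0$ such that for every $\alpha\ge\alpha_0$ the critical points of $V_\alpha$ are all nondegenerate and are in one-to-one correspondence with the effective Voronoi cells of positive codimension. If the charges are positive, the Morse index of each critical point equals the dimension of the corresponding cell; if they are negative, it equals the codimension of that cell (equivalently, the dimension of the cell is the Morse index for $-V_\alpha$). **(b)** If $L$ intersects the Voronoi diagram generically, then there is $\alpha_0>0$ (depending on the configuration of charges and on $L$) such that for every $\alpha\ge\alpha_0$ the critical points of the restriction of $V_\alpha$ to $L\setminus\{c_1,\dots,c_l\}$ are all nondegenerate and are in one-to-one correspondence with the Voronoi cells $S$ that are effective with respect to $L$ and either have positive codimension or have no nearest site on $L$ (that is, all cells effective with respect to $L$ except the full-dimensional cells whose site lies on $L$). If the charges are positive, the Morse index of each critical point equals $\dim(S\cap L)$ for the corresponding cell $S$; if they are negative, it equals $\dim L-\dim(S\cap L)$ (equivalently, $\dim(S\cap L)$ is the Morse index for $-V_\alpha$ restricted to $L$). -/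

import Mathlib

noncomputable section

namespace PointCharges

/-- Euclidean space `ℝⁿ`. -/
abbrev Space (n : ℕ) : Type := EuclideanSpace ℝ (Fin n)

/-! ### Critical points, nondegeneracy and Morse index of a real function on a normed space -/

section Morse

variable {E : Type*} [NormedAddCommGroup E] [NormedSpace ℝ E]

/-- `x` is a critical point of `g`: `g` is differentiable at `x` with zero differential. -/
def IsCriticalPt (g : E → ℝ) (x : E) : Prop :=
  HasFDerivAt g (0 : E →L[ℝ] ℝ) x

/-- The Hessian of `g` at `x`, as a bilinear form. -/
def hessian (g : E → ℝ) (x : E) : E →L[ℝ] E →L[ℝ] ℝ :=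
  fderiv ℝ (fderiv ℝ g) x

/-- The Hessian of `g` at `x` is a nondegenerate bilinear form. -/
def IsNondegenerateAt (g : E → ℝ) (x : E) : Prop :=
  ∀ u : E, (∀ v : E, hessian g x u v = 0) → u = 0

/-- The Morse index of `g` at `x`: the largest dimension of a linear subspace on which the
Hessian is negative definite. -/
def morseIndex (g : E → ℝ) (x : E) : ℕ :=
  sSup {d : ℕ | ∃ W : Submodule ℝ E, Module.finrank ℝ W = d ∧
    ∀ v ∈ W, v ≠ 0 → hessian g x v v < 0}

end Morse

variable {n : ℕ} {ι : Type*}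

/-! ### The potential -/

/-- The potential `V_α(x) = ∑ i, ζ i / ρ_i(x) ^ α`, where `ρ_i(x) = |x - c i|²`. It is only
meaningful away from the charges `c i`. -/
def potential [Fintype ι] (c : ι → Space n) (ζ : ι → ℝ) (α : ℝ) (x : Space n) : ℝ :=
  ∑ i, ζ i / (dist x (c i) ^ 2) ^ α

/-- The critical points of `V_α` on its domain, the complement of the set of charges. -/
def criticalPoints [Fintype ι] (c : ι → Space n) (ζ : ι → ℝ) (α : ℝ) : Set (Space n) :=
  {x | (∀ i, x ≠ c i) ∧ IsCriticalPt (potential c ζ α) x}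

/-- The restriction of `f` to the affine subspace through `x` parallel to `L`, read in the
coordinate `v ↦ x + v`, where `v` runs through the direction of `L`; for `x ∈ L` this is the
restriction of `f` to `L`, with `x` as origin. -/
def restrictAt (f : Space n → ℝ) (L : AffineSubspace ℝ (Space n)) (x : Space n) :
    L.direction → ℝ :=
  fun v => f (x + (v : Space n))

/-- The critical points of the restriction of `V_α` to `L`, on its domain, the set of points
of `L` that are not charges. -/
def criticalPointsOn [Fintype ι] (c : ι → Space n) (ζ : ι → ℝ) (α : ℝ)
    (L : AffineSubspace ℝ (Space n)) : Set (Space n) :=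
  {x | x ∈ L ∧ (∀ i, x ≠ c i) ∧ IsCriticalPt (restrictAt (potential c ζ α) L x) 0}

/-! ### Voronoi diagrams -/

/-- The (indices of the) sites nearest to `x`. -/
def nearestSites (c : ι → Space n) (x : Space n) : Set ι :=
  {i | ∀ j, dist x (c i) ≤ dist x (c j)}

/-- The set of points whose set of nearest sites is exactly `I`. The Voronoi cells are the
nonempty sets of this form; a cell determines `I`, its set `NS(S)` of nearest sites, and so the
cells are indexed below by the sets `I` with `voronoiCell c I` nonempty. -/
def voronoiCell (c : ι → Space n) (I : Set ι) : Set (Space n) :=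
  {x | nearestSites c x = I}

/-- The dimension of a convex set: the dimension of its affine span. -/
def convexDim (S : Set (Space n)) : ℕ :=
  Module.finrank ℝ (vectorSpan ℝ S)

/-- The codimension in `ℝⁿ` of a convex set (`convexDim S ≤ n`). -/
def convexCodim (S : Set (Space n)) : ℕ :=
  n - convexDim S

/-- A configuration is generic if each Voronoi cell `S` of codimension `k` has exactly `k + 1`
nearest sites and does not meet the (relative) boundary of the convex hull of `NS(S)`. -/
def IsGeneric (c : ι → Space n) : Prop :=
  ∀ I : Set ι, (voronoiCell c I).Nonempty →
    I.encard = convexCodim (voronoiCell c I) + 1 ∧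
    Disjoint (voronoiCell c I) (intrinsicFrontier ℝ (convexHull ℝ (c '' I)))

/-- The Voronoi cell with nearest sites `I` is effective if it meets the convex hull of its
nearest sites. -/
def IsEffective (c : ι → Space n) (I : Set ι) : Prop :=
  (voronoiCell c I ∩ convexHull ℝ (c '' I)).Nonempty

/-- The effective Voronoi cells of positive codimension. -/
def effectiveCells (c : ι → Space n) : Set (Set ι) :=
  {I | (voronoiCell c I).Nonempty ∧ 0 < convexCodim (voronoiCell c I) ∧ IsEffective c I}

/-- The orthogonal projections to `L` of the sites with index in `I`. -/
def projectedSites (c : ι → Space n) (L : AffineSubspace ℝ (Space n)) [Nonempty L] (I : Set ι) :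
    Set (Space n) :=
  (fun i => (EuclideanGeometry.orthogonalProjection L (c i) : Space n)) '' I

/-- `L` meets the Voronoi diagram generically: every Voronoi cell `S` that meets `L` is
transversal to `L`, has exactly `k + 1` nearest sites where `k` is its codimension, and does not
meet the (relative) boundary of the convex hull of the projection of `NS(S)` to `L`. -/
def MeetsGenerically (c : ι → Space n) (L : AffineSubspace ℝ (Space n)) [Nonempty L] : Prop :=
  ∀ I : Set ι, (voronoiCell c I ∩ (L : Set (Space n))).Nonempty →
    vectorSpan ℝ (voronoiCell c I) ⊔ L.direction = ⊤ ∧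
    I.encard = convexCodim (voronoiCell c I) + 1 ∧
    Disjoint (voronoiCell c I) (intrinsicFrontier ℝ (convexHull ℝ (projectedSites c L I)))

/-- The Voronoi cell with nearest sites `I` is effective with respect to `L` if it meets the
convex hull of the orthogonal projection to `L` of its nearest sites. -/
def IsEffectiveOn (c : ι → Space n) (L : AffineSubspace ℝ (Space n)) [Nonempty L]
    (I : Set ι) : Prop :=
  (voronoiCell c I ∩ convexHull ℝ (projectedSites c L I)).Nonempty

/-- The cells effective with respect to `L` that have positive codimension or whose nearest
sites lie off `L`. (The cells left out are the full-dimensional ones around a charge on `L`.) -/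
def effectiveCellsOn (c : ι → Space n) (L : AffineSubspace ℝ (Space n)) [Nonempty L] :
    Set (Set ι) :=
  {I | (voronoiCell c I).Nonempty ∧
    (0 < convexCodim (voronoiCell c I) ∨ ∀ i ∈ I, c i ∉ L) ∧ IsEffectiveOn c L I}

end PointCharges

end

open PointCharges

noncomputable section

namespace PointCharges

open Filter Topology Set

set_option linter.unusedSectionVars false

/-! ### Morse index from a splitting of the space -/

section MorseSplitting

variable {E : Type*} [NormedAddCommGroup E] [NormedSpace ℝ E]

/-! By Pythagoras, on `L` one has `ρ_i = |v - b_i|² + h_i`, where `b_i` is the projection of the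
site and `h_i` its squared distance to `L`. So (b), and with `h = 0` also (a), concern the energy `∑
ζ_i / ρ_i ^ α` of points `b_i` with heights `h_i ≥ 0`. Negative charges reduce to positive ones by
changing the sign of the energy.

Put `s = α + 1`. The gradient vanishes at `v` exactly when `v = ∑ w_i b_i`, where the weights `w_i`
are proportional to `ζ_i ρ_i ^ (-s)` and sum to one (`energyDeriv_eq_zero_iff`). For large `s` the
weights concentrate on the minimizers of `ρ_i`. By compactness of the simplex, weights of critical
points accumulate only at vectors `p` supported on the set `I` of minimizers at `∑ p_i b_i`;
genericity makes `p` positive on all of `I` and unique for `I` (`eventually_weight_mem`).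
Accumulation at a singularity is excluded by `eventually_notMem_balanced`.

Conversely, near such a `p` the unknown is taken to be the weight vector, with `t = 1 / s`. For `j,
k ∈ I` the logarithm of the weight ratio, divided by `s`, gives `log (ρ_j / ρ_k) = t (log (ζ_j /
ζ_k) - log (p_j / p_k))`; for `j ∉ I` the weight is a flat function of `t`. The system is thus
regular at `t = 0`, its derivative in `p` is injective because the `b_i`, `i ∈ I`, are affinely
independent, and the inverse function theorem gives exactly one solution nearby
(`exists_nhds_existsUnique_balanced`).

At a critical point the Hessian is a positive multiple of `2 s ∑ w_i ⟨v - b_i, u⟩² / ρ_i - |u|²`.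
Along the affine span of `b(I)` the sum is bounded below on unit vectors and the factor `s` wins;
orthogonally to it only the exponentially small weights off `I` contribute and `-|u|²` wins
(`eventually_hessian_sign`). The orthogonal complement is the direction of the cell
(`vectorSpan_minimizers_eq`), which gives the index. -/

theorem isNondegenerateAt_of_isCompl {g : E → ℝ} {x : E} {D D' : Submodule ℝ E}
    (hD : IsCompl D D') (hsymm : ∀ u v, hessian g x u v = hessian g x v u)
    (hpos : ∀ u ∈ D, u ≠ 0 → 0 < hessian g x u u)
    (hneg : ∀ u ∈ D', u ≠ 0 → hessian g x u u < 0) : IsNondegenerateAt g x := by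
  intro u hu
  obtain ⟨a, ha, c, hc, rfl⟩ := Submodule.mem_sup.1 (hD.sup_eq_top ▸ Submodule.mem_top (x := u))
  -- By symmetry the cross terms cancel against `a - c`, leaving a positive minus a negative term.
  have h := hu (a - c)
  have h2 : hessian g x a a - hessian g x c c = 0 := by
    have h3 := hsymm a c
    simp only [map_add, map_sub, _root_.add_apply] at h
    linarith
  by_cases ha0 : a = 0
  · by_cases hc0 : c = 0
    · simp [ha0, hc0]
    · have := hneg c hc hc0
      simp only [ha0, map_zero] at h2
      linarith
  · have h4 := hpos a ha ha0
    by_cases hc0 : c = 0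
    · simp only [hc0, map_zero] at h2
      linarith
    · have := hneg c hc hc0
      linarith

/-- A negative definite subspace meets `D` only in zero, so its dimension is at most the codimension
of `D`. -/
theorem morseIndex_eq_finrank [FiniteDimensional ℝ E] {g : E → ℝ} {x : E} {D D' : Submodule ℝ E}
    (hD : IsCompl D D')
    (hpos : ∀ u ∈ D, u ≠ 0 → 0 < hessian g x u u)
    (hneg : ∀ u ∈ D', u ≠ 0 → hessian g x u u < 0) :
    morseIndex g x = Module.finrank ℝ D' := by
  refine IsGreatest.csSup_eq ⟨⟨D', rfl, hneg⟩, ?_⟩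
  rintro d ⟨W, rfl, hW⟩
  have hdisj : Disjoint W D := by
    rw [Submodule.disjoint_def]
    intro u hu hu'
    by_contra h0
    exact absurd (hW u hu h0) (hpos u hu' h0).le.not_gt
  have h1 := Submodule.finrank_add_finrank_le_of_disjoint hdisj
  have h2 := Submodule.finrank_add_eq_of_isCompl hD
  omega

theorem hessian_neg (g : E → ℝ) (x : E) : hessian (fun y => -g y) x = -hessian g x := by
  have : fderiv ℝ (fun y => -g y) = fun y => -fderiv ℝ g y := by
    funext y
    exact fderiv_fun_neg
  rw [hessian, this, fderiv_fun_neg, hessian]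

theorem hessian_comp_add_left (g : E → ℝ) (a x : E) :
    hessian (fun y => g (a + y)) x = hessian g (a + x) := by
  have : fderiv ℝ (fun y => g (a + y)) = fun y => fderiv ℝ g (a + y) := by
    funext y
    exact fderiv_comp_add_left a
  rw [hessian, this, fderiv_comp_add_left, hessian]

theorem isCriticalPt_comp_add_left (g : E → ℝ) (a x : E) :
    IsCriticalPt (fun y => g (a + y)) x ↔ IsCriticalPt g (a + x) := by
  constructor
  · intro h
    have h1 : HasFDerivAt (fun z : E => z - a) (ContinuousLinearMap.id ℝ E) (a + x) :=
      (hasFDerivAt_id _).sub_const a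
    have h2 : HasFDerivAt (fun y => g (a + y)) (0 : E →L[ℝ] ℝ) (a + x - a) := by
      rw [add_sub_cancel_left]
      exact h
    have h3 := h2.comp (a + x) h1
    simpa [IsCriticalPt, Function.comp_def] using h3
  · intro h
    have h1 : HasFDerivAt (fun z : E => a + z) (ContinuousLinearMap.id ℝ E) x :=
      (hasFDerivAt_id _).const_add a
    have h3 := HasFDerivAt.comp x (f := fun z : E => a + z) h h1
    simpa [IsCriticalPt, Function.comp_def] using h3

end MorseSplitting

/-! ### Power distances and the energy of a weighted configuration -/

section Energy

variable {E : Type*} [NormedAddCommGroup E] [InnerProductSpace ℝ E] {ι : Type*}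

/-- The power distance `|v - b i|² + h i`. -/
def powerDist (b : ι → E) (h : ι → ℝ) (i : ι) (v : E) : ℝ := ‖v - b i‖ ^ 2 + h i

/-- The energy `∑ i, ζ i / (|v - b i|² + h i) ^ α`. -/
def energy [Fintype ι] (b : ι → E) (h ζ : ι → ℝ) (α : ℝ) (v : E) : ℝ :=
  ∑ i, ζ i / powerDist b h i v ^ α

theorem powerDist_nonneg {b : ι → E} {h : ι → ℝ} (hh : ∀ i, 0 ≤ h i) (i : ι) (v : E) :
    0 ≤ powerDist b h i v := add_nonneg (sq_nonneg _) (hh i)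

theorem hasStrictFDerivAt_powerDist (b : ι → E) (h : ι → ℝ) (i : ι) (v : E) :
    HasStrictFDerivAt (powerDist b h i) ((2 : ℝ) • innerSL ℝ (v - b i)) v := by
  have h1 : HasStrictFDerivAt (fun v : E => v - b i) (ContinuousLinearMap.id ℝ E) v :=
    (hasStrictFDerivAt_id v).sub_const (b i)
  have h2 := (HasStrictFDerivAt.comp v (hasStrictFDerivAt_norm_sq (v - b i)) h1).add_const (h i)
  refine h2.congr_fderiv ?_
  ext u
  simp

theorem continuous_powerDist (b : ι → E) (h : ι → ℝ) (i : ι) : Continuous (powerDist b h i) := by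
  unfold powerDist
  fun_prop

variable [Fintype ι]

/-- The differential of the energy. -/
def energyDeriv (b : ι → E) (h ζ : ι → ℝ) (α : ℝ) (v : E) : E →L[ℝ] ℝ :=
  ∑ i, (-(2 * α) * ζ i * powerDist b h i v ^ (-(α + 1))) • innerSL ℝ (v - b i)

theorem hasFDerivAt_energy {b : ι → E} {h : ι → ℝ} (hh : ∀ i, 0 ≤ h i) (ζ : ι → ℝ) (α : ℝ) {v : E}
    (hv : ∀ i, 0 < powerDist b h i v) :
    HasFDerivAt (energy b h ζ α) (energyDeriv b h ζ α v) v := by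
  have he : energy b h ζ α = fun v => ∑ i, ζ i * powerDist b h i v ^ (-α) := by
    funext v
    exact Finset.sum_congr rfl fun i _ => by
      rw [Real.rpow_neg (powerDist_nonneg hh i v), div_eq_mul_inv]
  rw [he]
  refine HasFDerivAt.fun_sum fun i _ => ?_
  have h1 := ((hasStrictFDerivAt_powerDist b h i v).hasFDerivAt.rpow_const (p := -α)
    (Or.inl (hv i).ne')).const_mul (ζ i)
  refine h1.congr_fderiv ?_
  ext u
  simp only [_root_.smul_apply, smul_eq_mul]
  rw [show -α - 1 = -(α + 1) by ring]
  ring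

theorem fderiv_energy_eventuallyEq {b : ι → E} {h : ι → ℝ} (hh : ∀ i, 0 ≤ h i) (ζ : ι → ℝ) (α : ℝ)
    {v : E} (hv : ∀ i, 0 < powerDist b h i v) :
    fderiv ℝ (energy b h ζ α) =ᶠ[𝓝 v] energyDeriv b h ζ α := by
  have : ∀ᶠ w in 𝓝 v, ∀ i, 0 < powerDist b h i w :=
    eventually_all.2 fun i => (continuous_powerDist b h i).continuousAt.eventually (lt_mem_nhds (hv i))
  filter_upwards [this] with w hw using (hasFDerivAt_energy hh ζ α hw).fderiv

theorem hessian_energy {b : ι → E} {h : ι → ℝ} (hh : ∀ i, 0 ≤ h i) (ζ : ι → ℝ) (α : ℝ)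
    {v : E} (hv : ∀ i, 0 < powerDist b h i v) (u u' : E) :
    hessian (energy b h ζ α) v u u' = 2 * α * ∑ i, ζ i * powerDist b h i v ^ (-(α + 1)) *
      (2 * (α + 1) * inner ℝ (v - b i) u * inner ℝ (v - b i) u' / powerDist b h i v
        - inner ℝ u u') := by
  rw [hessian, (fderiv_energy_eventuallyEq hh ζ α hv).fderiv_eq]
  -- `innerSL` is conjugate-linear in its first variable; over `ℝ` this retypes it as a linear map,
  -- which can be its own derivative.
  obtain ⟨B, hB⟩ : ∃ B : E →L[ℝ] E →L[ℝ] ℝ, ∀ w, B w = innerSL ℝ w := ⟨innerSL ℝ, fun _ => rfl⟩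
  have key : HasFDerivAt (energyDeriv b h ζ α)
      (∑ i, ((-(2 * α) * ζ i * powerDist b h i v ^ (-(α + 1))) • B
        + ((-(2 * α) * ζ i) • ((-(α + 1)) * powerDist b h i v ^ (-(α + 1) - 1)) •
          ((2 : ℝ) • innerSL ℝ (v - b i))).smulRight (innerSL ℝ (v - b i)))) v := by
    refine HasFDerivAt.fun_sum fun i _ => ?_
    have h1 := ((hasStrictFDerivAt_powerDist b h i v).hasFDerivAt.rpow_const (p := -(α + 1))
      (Or.inl (hv i).ne')).const_mul (-(2 * α) * ζ i)
    have h2 : HasFDerivAt (fun w : E => innerSL ℝ (w - b i)) B v := by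
      have h3 : HasFDerivAt (fun w : E => w - b i) (ContinuousLinearMap.id ℝ E) v :=
        (hasFDerivAt_id v).sub_const (b i)
      simp only [← hB]
      exact B.hasFDerivAt.comp v h3
    exact h1.smul h2
  rw [key.fderiv]
  simp only [_root_.sum_apply, _root_.add_apply,
    _root_.smul_apply, ContinuousLinearMap.smulRight_apply, hB, innerSL_apply_apply,
    smul_eq_mul, Finset.mul_sum]
  refine Finset.sum_congr rfl fun i _ => ?_
  rw [Real.rpow_sub_one (hv i).ne']
  have := (hv i).ne'
  field_simp
  ring

/-- The coefficients of `v` as a combination of the `b i` at a critical point `v` of the energy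
with exponent `s - 1`. -/
def weight (b : ι → E) (h ζ : ι → ℝ) (s : ℝ) (v : E) (i : ι) : ℝ :=
  ζ i * powerDist b h i v ^ (-s) / ∑ j, ζ j * powerDist b h j v ^ (-s)

/-- The linear combination of the points `b i` with coefficients `p`. -/
def comb (b : ι → E) : (ι → ℝ) →ₗ[ℝ] E := Fintype.linearCombination ℝ b

theorem comb_apply (b : ι → E) (p : ι → ℝ) : comb b p = ∑ i, p i • b i := rfl

/-- The points off the singularities that are the combination of the `b i` with coefficients
their weights, for the exponent `s`. -/
def balanced (b : ι → E) (h ζ : ι → ℝ) (s : ℝ) : Set E :=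
  {v | (∀ i, 0 < powerDist b h i v) ∧ comb b (weight b h ζ s v) = v}

section

variable {b : ι → E} {h ζ : ι → ℝ} {s : ℝ} {v : E}

theorem sum_weightTerm_pos [Nonempty ι] (hζ : ∀ i, 0 < ζ i) (hv : ∀ i, 0 < powerDist b h i v) :
    0 < ∑ j, ζ j * powerDist b h j v ^ (-s) :=
  Finset.sum_pos (fun i _ => mul_pos (hζ i) (Real.rpow_pos_of_pos (hv i) _))
    Finset.univ_nonempty

theorem weight_pos [Nonempty ι] (hζ : ∀ i, 0 < ζ i) (hv : ∀ i, 0 < powerDist b h i v) (i : ι) :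
    0 < weight b h ζ s v i :=
  div_pos (mul_pos (hζ i) (Real.rpow_pos_of_pos (hv i) _)) (sum_weightTerm_pos hζ hv)

theorem sum_weight [Nonempty ι] (hζ : ∀ i, 0 < ζ i) (hv : ∀ i, 0 < powerDist b h i v) :
    ∑ i, weight b h ζ s v i = 1 := by
  simp only [weight, ← Finset.sum_div]
  exact div_self (sum_weightTerm_pos hζ hv).ne'

theorem weight_div [Nonempty ι] (hζ : ∀ i, 0 < ζ i) (hv : ∀ i, 0 < powerDist b h i v) (i j : ι) :
    weight b h ζ s v i =
      weight b h ζ s v j * (ζ i / ζ j) * (powerDist b h j v / powerDist b h i v) ^ s := by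
  have h1 := (sum_weightTerm_pos (s := s) hζ hv).ne'
  have h2 := (hζ j).ne'
  have h3 := (Real.rpow_pos_of_pos (hv i) s).ne'
  have h4 := (Real.rpow_pos_of_pos (hv j) s).ne'
  rw [Real.div_rpow (hv j).le (hv i).le]
  simp only [weight, Real.rpow_neg (hv _).le] at h1 ⊢
  field_simp

/-- The ratios to one coordinate fix a vector up to a factor, which the total `1` determines. This
recognizes solutions of the ratio equations as weights. -/
theorem weight_eq_of_ratio [Nonempty ι] (hζ : ∀ i, 0 < ζ i) (hv : ∀ i, 0 < powerDist b h i v)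
    {p : ι → ℝ} (hp : ∑ i, p i = 1) (j : ι)
    (hr : ∀ i, p i = p j * (ζ i / ζ j) * (powerDist b h j v / powerDist b h i v) ^ s) :
    weight b h ζ s v = p := by
  have hw := weight_pos (s := s) hζ hv j
  have h1 : ∀ i, p i = p j / weight b h ζ s v j * weight b h ζ s v i := by
    intro i
    rw [weight_div hζ hv i j, hr i]
    field_simp
  have h2 : p j / weight b h ζ s v j = 1 := by
    have := sum_weight (s := s) hζ hv
    rw [Finset.sum_congr rfl fun i _ => h1 i, ← Finset.mul_sum, this, mul_one] at hp
    exact hp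
  funext i
  rw [h1 i, h2, one_mul]

/-- The gradient is `2 α W (∑ w_i b_i - v)`, with `W > 0` the normalizing sum of the weights. -/
theorem energyDeriv_eq_zero_iff [Nonempty ι] {α : ℝ} (hα : 0 < α) (hζ : ∀ i, 0 < ζ i)
    (hv : ∀ i, 0 < powerDist b h i v) :
    energyDeriv b h ζ α v = 0 ↔ comb b (weight b h ζ (α + 1) v) = v := by
  set W := ∑ j, ζ j * powerDist b h j v ^ (-(α + 1)) with hW
  have hW0 : 0 < W := sum_weightTerm_pos hζ hv
  have h1 : energyDeriv b h ζ α v =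
      innerSL ℝ ((2 * α * W) • (comb b (weight b h ζ (α + 1) v) - v)) := by
    have h2 : comb b (weight b h ζ (α + 1) v) - v =
        ∑ i, weight b h ζ (α + 1) v i • (b i - v) := by
      simp only [smul_sub, Finset.sum_sub_distrib, ← Finset.sum_smul, sum_weight hζ hv, one_smul,
        comb_apply]
    rw [h2, Finset.smul_sum, map_sum, energyDeriv]
    refine Finset.sum_congr rfl fun i _ => ?_
    rw [smul_smul, weight, ← hW, ← map_smul, ← neg_sub v (b i), smul_neg, ← neg_smul]
    congr 2
    field_simp
  rw [h1]
  constructor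
  · intro h2
    have h3 : (2 * α * W) • (comb b (weight b h ζ (α + 1) v) - v) = 0 := by
      have := congrArg (fun f => f ((2 * α * W) • (comb b (weight b h ζ (α + 1) v) - v))) h2
      simpa only [innerSL_apply_apply, _root_.zero_apply, inner_self_eq_zero] using this
    rcases smul_eq_zero.1 h3 with h4 | h4
    · exact absurd h4 (by positivity)
    · exact sub_eq_zero.1 h4
  · intro h2
    simp [h2]

theorem isCriticalPt_energy_iff [Nonempty ι] (hh : ∀ i, 0 ≤ h i) {α : ℝ} (hα : 0 < α)
    (hζ : ∀ i, 0 < ζ i) (hv : ∀ i, 0 < powerDist b h i v) :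
    IsCriticalPt (energy b h ζ α) v ↔ comb b (weight b h ζ (α + 1) v) = v := by
  rw [← energyDeriv_eq_zero_iff hα hζ hv, IsCriticalPt]
  have h1 := hasFDerivAt_energy hh ζ α hv
  exact ⟨fun h2 => h1.unique h2, fun h2 => h2 ▸ h1⟩

end

end Energy

/-! ### Minimizers of the power distances and barycentric coordinates -/

section Minimizers

variable {E : Type*} [NormedAddCommGroup E] [InnerProductSpace ℝ E] {ι : Type*}

/-- The indices of minimal power distance to `v`. -/
def minimizers (b : ι → E) (h : ι → ℝ) (v : E) : Set ι :=
  {i | ∀ j, powerDist b h i v ≤ powerDist b h j v}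

theorem powerDist_eq_of_mem_minimizers {b : ι → E} {h : ι → ℝ} {v : E} {i j : ι}
    (hi : i ∈ minimizers b h v) (hj : j ∈ minimizers b h v) :
    powerDist b h i v = powerDist b h j v := le_antisymm (hi j) (hj i)

theorem powerDist_lt_of_notMem_minimizers {b : ι → E} {h : ι → ℝ} {v : E} {i j : ι}
    (hi : i ∈ minimizers b h v) (hj : j ∉ minimizers b h v) :
    powerDist b h i v < powerDist b h j v := by
  by_contra hc
  exact hj fun k => (not_lt.1 hc).trans (hi k)

theorem minimizers_nonempty [Finite ι] [Nonempty ι] (b : ι → E) (h : ι → ℝ) (v : E) :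
    (minimizers b h v).Nonempty := by
  obtain ⟨i, hi⟩ := Finite.exists_min fun i => powerDist b h i v
  exact ⟨i, hi⟩

/-- The quadratic terms cancel, so the difference of two power distances is affine in `v`; cells are
therefore cut out by affine conditions. -/
theorem powerDist_sub_powerDist (b : ι → E) (h : ι → ℝ) (i j : ι) (v v' : E) :
    (powerDist b h i v - powerDist b h j v) - (powerDist b h i v' - powerDist b h j v') =
      -2 * inner ℝ (v - v') (b i - b j) := by
  simp only [powerDist, norm_sub_sq_real, inner_sub_left, inner_sub_right]
  ring

theorem inner_sub_eq_zero_of_minimizers_eq {b : ι → E} {h : ι → ℝ} {v v' : E} {i j : ι}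
    (hv : minimizers b h v = minimizers b h v') (hi : i ∈ minimizers b h v)
    (hj : j ∈ minimizers b h v) : inner ℝ (v - v') (b i - b j) = 0 := by
  have h1 := powerDist_sub_powerDist b h i j v v'
  rw [powerDist_eq_of_mem_minimizers hi hj,
    powerDist_eq_of_mem_minimizers (i := i) (j := j)
      (v := v') (by rwa [← hv]) (by rwa [← hv])] at h1
  linarith

variable [Fintype ι]

theorem inner_comb_eq_zero {b : ι → E} {I : Set ι} {w : E} {q : ι → ℝ} (hq : ∀ i ∉ I, q i = 0)
    (hsum : ∑ i, q i = 0) (hw : ∀ i ∈ I, ∀ j ∈ I, inner ℝ w (b i - b j) = 0) :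
    inner ℝ w (comb b q) = 0 := by
  rcases I.eq_empty_or_nonempty with rfl | ⟨j, hj⟩
  · simp [comb_apply, fun i => hq i (notMem_empty i)]
  · have h1 : comb b q = ∑ i, q i • (b i - b j) := by
      simp only [smul_sub, Finset.sum_sub_distrib, ← Finset.sum_smul, hsum, zero_smul, sub_zero,
        comb_apply]
    rw [h1, inner_sum]
    refine Finset.sum_eq_zero fun i _ => ?_
    rw [inner_smul_right]
    by_cases hi : i ∈ I
    · rw [hw i hi j hj, mul_zero]
    · rw [hq i hi, zero_mul]

theorem eq_zero_of_affineIndependent {b : ι → E} {I : Set ι}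
    (hind : AffineIndependent ℝ fun i : I => b i) {q : ι → ℝ} (hq : ∀ i ∉ I, q i = 0)
    (hsum : ∑ i, q i = 0) (hcomb : comb b q = 0) : q = 0 := by
  classical
  have h1 : ∑ i : I, q i = 0 := by
    rw [← hsum]
    exact (Finset.sum_congr_set I q (fun i => q i) (fun _ _ => rfl) hq).symm
  have h2 : ∑ i : I, q i • b i = 0 := by
    rw [← hcomb, comb_apply]
    exact (Finset.sum_congr_set I (fun i => q i • b i) (fun i => q i • b i) (fun _ _ => rfl)
      fun i hi => by rw [hq i hi, zero_smul]).symm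
  funext i
  by_cases hi : i ∈ I
  · exact hind.eq_zero_of_sum_eq_zero (s := Finset.univ) (w := fun i : I => q i) h1 h2 ⟨i, hi⟩
      (Finset.mem_univ _)
  · exact hq i hi

/-- Every point `v` has affinely independent minimizers, and is not on the relative boundary of
their convex hull. -/
def IsPowerGeneric (b : ι → E) (h : ι → ℝ) : Prop :=
  ∀ v, AffineIndependent ℝ (fun i : minimizers b h v => b i) ∧
    v ∉ intrinsicFrontier ℝ (convexHull ℝ (b '' minimizers b h v))

/-- `p` is a vector of barycentric coordinates, positive exactly on `I`, of a point with set of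
minimizers `I`. -/
structure IsEffectiveWeight (b : ι → E) (h : ι → ℝ) (I : Set ι) (p : ι → ℝ) : Prop where
  pos : ∀ i ∈ I, 0 < p i
  zero : ∀ i ∉ I, p i = 0
  sum : ∑ i, p i = 1
  min : minimizers b h (comb b p) = I

/-- The difference of the two points lies in the direction of the affine span of `b(I)` and, both
points being in the same cell, is orthogonal to it. So it vanishes, and affine independence does the
rest. -/
theorem eq_of_minimizers_comb_eq {b : ι → E} {h : ι → ℝ} {I : Set ι} {p p' : ι → ℝ}
    (hind : AffineIndependent ℝ fun i : I => b i) (hp : ∀ i ∉ I, p i = 0) (hp' : ∀ i ∉ I, p' i = 0)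
    (hsum : ∑ i, p i = 1) (hsum' : ∑ i, p' i = 1) (hmin : minimizers b h (comb b p) = I)
    (hmin' : minimizers b h (comb b p') = I) : p = p' := by
  have hq : ∀ i ∉ I, (p - p') i = 0 := fun i hi => by simp [hp i hi, hp' i hi]
  have hs : ∑ i, (p - p') i = 0 := by simp [Finset.sum_sub_distrib, hsum, hsum']
  have hw : comb b (p - p') = 0 := by
    rw [← inner_self_eq_zero (𝕜 := ℝ)]
    refine inner_comb_eq_zero hq hs fun i hi j hj => ?_
    rw [map_sub]
    exact inner_sub_eq_zero_of_minimizers_eq (hmin.trans hmin'.symm) (hmin ▸ hi) (hmin ▸ hj)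
  exact sub_eq_zero.1 (eq_zero_of_affineIndependent hind hq hs hw)

theorem exists_weight_of_mem_convexHull_image (b : ι → E) (I : Set ι) {v : E}
    (hv : v ∈ convexHull ℝ (b '' I)) :
    ∃ p : ι → ℝ, (∀ i, 0 ≤ p i) ∧ (∀ i ∉ I, p i = 0) ∧ ∑ i, p i = 1 ∧ comb b p = v := by
  classical
  have hsub : convexHull ℝ (b '' I) ⊆
      comb b '' {p | (∀ i, 0 ≤ p i) ∧ (∀ i ∉ I, p i = 0) ∧ ∑ i, p i = 1} := by
    refine convexHull_min ?_ (Convex.linear_image ?_ _)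
    · rintro _ ⟨i, hi, rfl⟩
      refine ⟨Pi.single i 1, ⟨fun j => ?_, fun j hj => ?_, ?_⟩, ?_⟩
      · by_cases hji : j = i
        · subst hji; simp
        · simp [hji]
      · exact Pi.single_eq_of_ne (fun hji => hj (by rwa [hji])) _
      · simp
      · simp [comb_apply, Pi.single_apply]
    · rintro p ⟨h1, h2, h3⟩ q ⟨h4, h5, h6⟩ a c ha hc hac
      refine ⟨fun i => ?_, fun i hi => ?_, ?_⟩
      · exact add_nonneg (mul_nonneg ha (h1 i)) (mul_nonneg hc (h4 i))
      · simp [h2 i hi, h5 i hi]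
      · simp [Finset.sum_add_distrib, ← Finset.mul_sum, h3, h6, hac]
  obtain ⟨p, ⟨h1, h2, h3⟩, h4⟩ := hsub hv
  exact ⟨p, h1, h2, h3, h4⟩

theorem comb_mem_convexHull_image (b : ι → E) (I : Set ι) {p : ι → ℝ} (hp : ∀ i, 0 ≤ p i)
    (hz : ∀ i ∉ I, p i = 0) (hsum : ∑ i, p i = 1) : comb b p ∈ convexHull ℝ (b '' I) := by
  classical
  have h1 : ∑ i : I, p i = 1 := by
    rw [← hsum]
    exact (Finset.sum_congr_set I p (fun i => p i) (fun _ _ => rfl) hz).symm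
  have h2 : ∑ i : I, p i • b i = comb b p := by
    rw [comb_apply]
    exact (Finset.sum_congr_set I (fun i => p i • b i) (fun i => p i • b i) (fun _ _ => rfl)
      fun i hi => by rw [hz i hi, zero_smul]).symm
  rw [← h2]
  exact (convex_convexHull ℝ _).sum_mem (fun i _ => hp i) h1
    fun i _ => subset_convexHull ℝ _ ⟨i, i.2, rfl⟩

theorem exists_sub_mem_of_mem_intrinsicInterior {C : Set E} {v z : E}
    (hv : v ∈ intrinsicInterior ℝ C) (hz : z ∈ C) :
    ∃ ε : ℝ, 0 < ε ∧ v + ε • (v - z) ∈ C := by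
  obtain ⟨y, hy, rfl⟩ := mem_intrinsicInterior.1 hv
  have hz' : z ∈ affineSpan ℝ C := subset_affineSpan ℝ C hz
  -- The intrinsic interior is an interior in the affine span, so the line is parametrized there;
  -- the parameter `-t` continues it beyond `v`, away from `z`.
  let γ : ℝ → affineSpan ℝ C := fun t =>
    ⟨AffineMap.lineMap (y : E) z (-t), AffineMap.lineMap_mem _ y.2 hz'⟩
  have hγ : Continuous γ := by
    refine Continuous.subtype_mk ?_ _
    exact (AffineMap.lineMap_continuous (R := ℝ)).comp continuous_neg
  have h0 : γ 0 = y := by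
    ext1
    simp [γ]
  have h1 : ∀ᶠ t in 𝓝 (0 : ℝ), γ t ∈ ((↑) : affineSpan ℝ C → E) ⁻¹' C :=
    hγ.continuousAt.eventually (by rw [h0]; exact mem_interior_iff_mem_nhds.1 hy)
  obtain ⟨ε, h2, h3⟩ := ((h1.filter_mono nhdsWithin_le_nhds).and
    (self_mem_nhdsWithin : Ioi (0 : ℝ) ∈ 𝓝[>] 0)).exists
  refine ⟨ε, h3, ?_⟩
  have h4 : AffineMap.lineMap (y : E) z (-ε) = (y : E) + ε • ((y : E) - z) := by
    rw [AffineMap.lineMap_apply_module']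
    module
  rw [← h4]
  exact h2

/-- Off the relative boundary, the segment from `b i` to `v` extends a little beyond `v` inside the
hull. By affine independence its end has coordinates `p + ε (p - e_i)`, and nonnegativity of the
`i`-th one forces `p i > 0`. -/
theorem exists_isEffectiveWeight {b : ι → E} {h : ι → ℝ} (hgen : IsPowerGeneric b h) {v : E}
    (hv : v ∈ convexHull ℝ (b '' minimizers b h v)) :
    ∃ p, IsEffectiveWeight b h (minimizers b h v) p ∧ comb b p = v := by
  classical
  obtain ⟨p, h1, h2, h3, h4⟩ := exists_weight_of_mem_convexHull_image b _ hv
  obtain ⟨hind, hfr⟩ := hgen v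
  refine ⟨p, ⟨fun i hi => ?_, h2, h3, by rw [h4]⟩, h4⟩
  have hint : v ∈ intrinsicInterior ℝ (convexHull ℝ (b '' minimizers b h v)) := by
    rw [← intrinsicClosure_sdiff_intrinsicFrontier]
    exact ⟨subset_intrinsicClosure hv, hfr⟩
  obtain ⟨ε, hε, hC⟩ := exists_sub_mem_of_mem_intrinsicInterior hint
    (subset_convexHull ℝ _ ⟨i, hi, rfl⟩)
  obtain ⟨q, q1, q2, q3, q4⟩ := exists_weight_of_mem_convexHull_image b _ hC
  have hsing : comb b (Pi.single i 1) = b i := by simp [comb_apply, Pi.single_apply]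
  have hz : q - (p + ε • (p - Pi.single i 1)) = 0 := by
    refine eq_zero_of_affineIndependent hind (fun j hj => ?_) ?_ ?_
    · have : j ≠ i := fun hji => hj (hji ▸ hi)
      simp [q2 j hj, h2 j hj, this]
    · simp [Finset.sum_add_distrib, Finset.sum_sub_distrib, ← Finset.mul_sum, h3, q3]
    · rw [map_sub, map_add, map_smul, map_sub, hsing, h4, q4, sub_self]
  have h5 := congrFun hz i
  simp only [Pi.sub_apply, Pi.add_apply, Pi.smul_apply, Pi.single_eq_same, smul_eq_mul,
    Pi.zero_apply] at h5
  have h6 := q1 i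
  by_contra hcon
  nlinarith [h1 i]

end Minimizers

/-! ### Zeros of a one-parameter system -/

section ImplicitFunction

/-- Local existence and uniqueness of the zeros of `Ψ (t, ·)` for small `t`, when the partial
derivative at `(0, p₀)` is injective. -/
theorem existsUnique_zero_of_hasStrictFDerivAt {F : Type*} [NormedAddCommGroup F]
    [NormedSpace ℝ F] [FiniteDimensional ℝ F] {Ψ : ℝ × F → F} {p₀ : F} {A : ℝ × F →L[ℝ] F}
    (hΨ : HasStrictFDerivAt Ψ A (0, p₀)) (h0 : Ψ (0, p₀) = 0)
    (hker : ∀ q, A (0, q) = 0 → q = 0) :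
    (∃ U ∈ 𝓝 p₀, ∀ᶠ t in 𝓝 (0 : ℝ), ∀ p ∈ U, ∀ p' ∈ U,
      Ψ (t, p) = 0 → Ψ (t, p') = 0 → p = p') ∧
    ∀ U ∈ 𝓝 p₀, ∀ᶠ t in 𝓝 (0 : ℝ), ∃ p ∈ U, Ψ (t, p) = 0 := by
  have : CompleteSpace F := FiniteDimensional.complete ℝ F
  -- The inverse function theorem is applied to `(t, p) ↦ (t, Ψ (t, p))`, whose derivative is an
  -- injective endomorphism in finite dimension, hence invertible.
  let G : ℝ × F → ℝ × F := fun z => (z.1, Ψ z)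
  let B : ℝ × F →L[ℝ] ℝ × F := (ContinuousLinearMap.fst ℝ ℝ F).prod A
  have hB : Function.Injective B := by
    rw [injective_iff_map_eq_zero]
    rintro ⟨t, q⟩ hq
    have h1 : t = 0 := congrArg Prod.fst hq
    subst h1
    have h2 : A (0, q) = 0 := congrArg Prod.snd hq
    rw [hker q h2]
    rfl
  let e : (ℝ × F) ≃L[ℝ] (ℝ × F) :=
    (LinearEquiv.ofInjectiveEndo B.toLinearMap hB).toContinuousLinearEquiv
  have he : (e : ℝ × F →L[ℝ] ℝ × F) = B := by
    ext z <;> rfl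
  have hG : HasStrictFDerivAt G (e : ℝ × F →L[ℝ] ℝ × F) (0, p₀) := by
    rw [he]
    exact hasStrictFDerivAt_fst.prodMk hΨ
  constructor
  · have h1 : ∀ᶠ z : (ℝ × F) × (ℝ × F) in 𝓝 ((0, p₀), (0, p₀)), G z.1 = G z.2 → z.1 = z.2 := by
      let φ := hG.toOpenPartialHomeomorph G
      have hs : φ.source ∈ 𝓝 ((0 : ℝ), p₀) :=
        φ.open_source.mem_nhds hG.mem_toOpenPartialHomeomorph_source
      filter_upwards [prod_mem_nhds hs hs] with z hz h
      exact φ.injOn hz.1 hz.2 h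
    rw [nhds_prod_eq] at h1
    obtain ⟨W, hW, h2⟩ := mem_prod_self_iff.1 h1
    obtain ⟨T, hT, U, hU, hTU⟩ := mem_nhds_prod_iff.1 hW
    refine ⟨U, hU, ?_⟩
    filter_upwards [hT] with t ht p hp p' hp' hz hz'
    have h3 := @h2 ((t, p), (t, p')) ⟨hTU ⟨ht, hp⟩, hTU ⟨ht, hp'⟩⟩ (by simp [G, hz, hz'])
    exact congrArg Prod.snd h3
  · intro U hU
    have h1 : G '' (univ ×ˢ U) ∈ 𝓝 ((0 : ℝ), (0 : F)) := by
      have h2 := hG.map_nhds_eq_of_equiv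
      have h3 : G (0, p₀) = (0, 0) := by simp [G, h0]
      rw [h3] at h2
      rw [← h2]
      exact image_mem_map (prod_mem_nhds univ_mem hU)
    have h4 : ∀ᶠ t in 𝓝 (0 : ℝ), (t, (0 : F)) ∈ G '' (univ ×ˢ U) := by
      have h5 : Tendsto (fun t : ℝ => (t, (0 : F))) (𝓝 0) (𝓝 (0, 0)) :=
        (Continuous.prodMk_left (0 : F)).tendsto 0
      exact h5 h1
    filter_upwards [h4] with t ht
    obtain ⟨⟨t', p⟩, ⟨-, hp⟩, h6⟩ := ht
    have h7 : t' = t := congrArg Prod.fst h6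
    subst h7
    exact ⟨p, hp, congrArg Prod.snd h6⟩

end ImplicitFunction

/-- The function is smooth with a minimum at `0`. It extends `exp (-1 / x)` by zero to `x ≤ 0`,
which makes `t = 0` an interior point of the parameter range. -/
theorem hasStrictDerivAt_expNegInvGlue_zero : HasStrictDerivAt expNegInvGlue 0 0 := by
  have h1 : HasStrictDerivAt expNegInvGlue (deriv expNegInvGlue 0) 0 :=
    (expNegInvGlue.contDiff (n := 1)).contDiffAt.hasStrictDerivAt (by simp)
  have h2 : deriv expNegInvGlue 0 = 0 := by
    refine IsLocalMin.deriv_eq_zero (Filter.Eventually.of_forall fun x => ?_)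
    rw [expNegInvGlue.zero]
    exact expNegInvGlue.nonneg x
  rwa [h2] at h1

/-! ### Existence and uniqueness of balanced points near an effective weight -/

section LocalSolution

variable {E : Type*} [NormedAddCommGroup E] [InnerProductSpace ℝ E] {ι : Type*} [Fintype ι]

/-- `comb` as a continuous linear map. -/
def combL (b : ι → E) : (ι → ℝ) →L[ℝ] E := (comb b).toContinuousLinearMap

theorem combL_apply (b : ι → E) (p : ι → ℝ) : combL b p = comb b p := rfl

theorem continuous_comb (b : ι → E) : Continuous (comb b) := (combL b).continuous

/-- The logarithm of the ratio of two power distances, at a combination of the points `b i`. -/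
def logRatio (b : ι → E) (h : ι → ℝ) (j k : ι) (p : ι → ℝ) : ℝ :=
  Real.log (powerDist b h j (comb b p)) - Real.log (powerDist b h k (comb b p))

open Classical in
/-- The system of equations whose zeros, for `t = 1 / s`, are the weights of the balanced points
near an effective weight supported on `I`, with `k ∈ I`. -/
def balanceMap (b : ι → E) (h ζ : ι → ℝ) (I : Set ι) (k : ι) (z : ℝ × (ι → ℝ)) (j : ι) : ℝ :=
  if j = k then ∑ i, z.2 i - 1
  else if j ∈ I then
    logRatio b h j k z.2 - z.1 * (Real.log (ζ j / ζ k) - Real.log (z.2 j) + Real.log (z.2 k))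
  else z.2 j - z.2 k * (ζ j / ζ k) * expNegInvGlue (z.1 * (logRatio b h j k z.2)⁻¹)

variable {b : ι → E} {h ζ : ι → ℝ} {I : Set ι} {k : ι} {p₀ : ι → ℝ}

theorem hasStrictFDerivAt_logRatio (j k : ι) (t : ℝ)
    (hj : powerDist b h j (comb b p₀) ≠ 0) (hk : powerDist b h k (comb b p₀) ≠ 0) :
    ∃ A : ℝ × (ι → ℝ) →L[ℝ] ℝ,
      HasStrictFDerivAt (fun z : ℝ × (ι → ℝ) => logRatio b h j k z.2) A (t, p₀) ∧
      ∀ z, A z = 2 * inner ℝ (comb b p₀ - b j) (comb b z.2) / powerDist b h j (comb b p₀) -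
        2 * inner ℝ (comb b p₀ - b k) (comb b z.2) / powerDist b h k (comb b p₀) := by
  have h1 : HasStrictFDerivAt (fun z : ℝ × (ι → ℝ) => comb b z.2)
      ((combL b).comp (ContinuousLinearMap.snd ℝ ℝ (ι → ℝ))) (t, p₀) :=
    ((combL b).comp (ContinuousLinearMap.snd ℝ ℝ (ι → ℝ))).hasStrictFDerivAt
  have h2 := fun i => (HasStrictFDerivAt.comp (t, p₀)
    (hasStrictFDerivAt_powerDist b h i (comb b p₀)) h1)
  refine ⟨_, ((h2 j).log hj).sub ((h2 k).log hk), fun z => ?_⟩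
  simp [combL_apply, -map_sub]
  ring

/-- Only the part of the derivative along `p` matters. At `t = 0` the logarithms of the weights
carry the factor `0`, the power distances with indices in `I` agree, and the flat term vanishes
together with its derivative. -/
theorem hasStrictFDerivAt_balanceMap (hk : k ∈ I) (hp : IsEffectiveWeight b h I p₀)
    (hpos : ∀ i, 0 < powerDist b h i (comb b p₀)) :
    ∃ A : ℝ × (ι → ℝ) →L[ℝ] (ι → ℝ), HasStrictFDerivAt (balanceMap b h ζ I k) A (0, p₀) ∧
      (∀ q, A (0, q) k = ∑ i, q i) ∧
      (∀ q, ∀ j ∈ I, j ≠ k → A (0, q) j =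
        2 * inner ℝ (b k - b j) (comb b q) / powerDist b h k (comb b p₀)) ∧
      ∀ q, ∀ j ∉ I, A (0, q) j = q j := by
  classical
  have hproj : ∀ i, HasStrictFDerivAt (fun z : ℝ × (ι → ℝ) => z.2 i)
      ((ContinuousLinearMap.proj i).comp (ContinuousLinearMap.snd ℝ ℝ (ι → ℝ))) (0, p₀) := fun i =>
    ((ContinuousLinearMap.proj i).comp (ContinuousLinearMap.snd ℝ ℝ (ι → ℝ))).hasStrictFDerivAt
  have key : ∀ j, ∃ A : ℝ × (ι → ℝ) →L[ℝ] ℝ,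
      HasStrictFDerivAt (fun z => balanceMap b h ζ I k z j) A (0, p₀) ∧
      (j = k → ∀ q, A (0, q) = ∑ i, q i) ∧
      (j ∈ I → j ≠ k → ∀ q, A (0, q) =
        2 * inner ℝ (b k - b j) (comb b q) / powerDist b h k (comb b p₀)) ∧
      (j ∉ I → ∀ q, A (0, q) = q j) := by
    intro j
    by_cases hjk : j = k
    · refine ⟨∑ i, (ContinuousLinearMap.proj i).comp (ContinuousLinearMap.snd ℝ ℝ (ι → ℝ)), ?_,
        fun _ => ?_, fun _ hc => absurd hjk hc, fun hc => absurd (hjk ▸ hk) hc⟩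
      · simp only [balanceMap, if_pos hjk]
        exact (HasStrictFDerivAt.fun_sum fun i _ => hproj i).sub_const 1
      · intro q
        simp
    · by_cases hj : j ∈ I
      · obtain ⟨A, hA, hA'⟩ := hasStrictFDerivAt_logRatio (b := b) (h := h) (p₀ := p₀) j k 0
          (hpos j).ne' (hpos k).ne'
        have h1 : HasStrictFDerivAt (fun z : ℝ × (ι → ℝ) => z.1)
          (ContinuousLinearMap.fst ℝ ℝ (ι → ℝ)) (0, p₀) := hasStrictFDerivAt_fst
        have h2 := ((hproj j).log (hp.pos j hj).ne').const_sub (Real.log (ζ j / ζ k))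
        have h3 := h2.add ((hproj k).log (hp.pos k hk).ne')
        refine ⟨_, (hA.sub (h1.mul h3)).congr_of_eventuallyEq (.of_forall fun z => ?_),
          fun hc => absurd hc hjk, fun _ _ => ?_, fun hc => absurd hj hc⟩
        · simp [balanceMap, if_neg hjk, if_pos hj]
        · intro q
          have h4 : powerDist b h j (comb b p₀) = powerDist b h k (comb b p₀) :=
            powerDist_eq_of_mem_minimizers (by rwa [hp.min]) (by rwa [hp.min])
          simp [hA', h4, inner_sub_left]
          ring
      · obtain ⟨A, hA, -⟩ := hasStrictFDerivAt_logRatio (b := b) (h := h) (p₀ := p₀) j k 0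
          (hpos j).ne' (hpos k).ne'
        have h0 : logRatio b h j k p₀ ≠ 0 := by
          have h1 : powerDist b h k (comb b p₀) < powerDist b h j (comb b p₀) :=
            powerDist_lt_of_notMem_minimizers (by rwa [hp.min]) (by rwa [hp.min])
          exact (sub_pos.2 (Real.log_lt_log (hpos k) h1)).ne'
        have h1 : HasStrictFDerivAt (fun z : ℝ × (ι → ℝ) => z.1)
          (ContinuousLinearMap.fst ℝ ℝ (ι → ℝ)) (0, p₀) := hasStrictFDerivAt_fst
        have h2 := h1.mul ((hasStrictDerivAt_inv h0).comp_hasStrictFDerivAt ((0 : ℝ), p₀) hA)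
        have h3 : HasStrictDerivAt expNegInvGlue 0
            (((0 : ℝ), p₀).1 * (logRatio b h j k ((0 : ℝ), p₀).2)⁻¹) := by
          simpa using hasStrictDerivAt_expNegInvGlue_zero
        have h4 := h3.comp_hasStrictFDerivAt ((0 : ℝ), p₀) h2
        refine ⟨_, ((hproj j).sub (((hproj k).mul_const (ζ j / ζ k)).mul h4)).congr_of_eventuallyEq
          (.of_forall fun z => ?_), fun hc => absurd hc hjk, fun hc => absurd hc hj, fun _ => ?_⟩
        · simp [balanceMap, if_neg hjk, if_neg hj]
        · intro q
          simp
  choose A hA h1 h2 h3 using key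
  exact ⟨ContinuousLinearMap.pi A, hasStrictFDerivAt_pi.2 hA, fun q => h1 k rfl q,
    fun q j hj hjk => h2 j hj hjk q, fun q j hj => h3 j hj q⟩

theorem balanceMap_zero (hk : k ∈ I) (hp : IsEffectiveWeight b h I p₀) :
    balanceMap b h ζ I k (0, p₀) = 0 := by
  classical
  funext j
  simp only [balanceMap]
  split_ifs with h1 h2
  · simp [hp.sum]
  · have h4 : powerDist b h j (comb b p₀) = powerDist b h k (comb b p₀) :=
      powerDist_eq_of_mem_minimizers (by rwa [hp.min]) (by rwa [hp.min])
    simp [logRatio, h4]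
  · simp [hp.zero j h2, expNegInvGlue.zero]

theorem exp_neg_mul_logRatio {p : ι → ℝ} {j : ι} {s : ℝ} (hj : 0 < powerDist b h j (comb b p))
    (hk : 0 < powerDist b h k (comb b p)) : Real.exp (-(s * logRatio b h j k p)) =
      (powerDist b h k (comb b p) / powerDist b h j (comb b p)) ^ s := by
  rw [Real.rpow_def_of_pos (div_pos hk hj), Real.log_div hk.ne' hj.ne', logRatio]
  congr 1
  ring

/-- On `I` the equation is the logarithm of the ratio equation divided by `s`. Off `I` it is the
ratio equation itself, because `expNegInvGlue x = exp (-1 / x)` at `x = 1 / (s * logRatio) > 0`. -/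
theorem balanceMap_eq_zero_iff (hk : k ∈ I) (hζ : ∀ i, 0 < ζ i) {p : ι → ℝ} {s : ℝ} (hs : 0 < s)
    (hpI : ∀ i ∈ I, 0 < p i) (hpos : ∀ i, 0 < powerDist b h i (comb b p))
    (hlog : ∀ j ∉ I, 0 < logRatio b h j k p) :
    balanceMap b h ζ I k (s⁻¹, p) = 0 ↔ ∑ i, p i = 1 ∧ ∀ j, p j = p k * (ζ j / ζ k) *
      (powerDist b h k (comb b p) / powerDist b h j (comb b p)) ^ s := by
  classical
  have hj : ∀ j, j ≠ k → (balanceMap b h ζ I k (s⁻¹, p) j = 0 ↔ p j = p k * (ζ j / ζ k) *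
      (powerDist b h k (comb b p) / powerDist b h j (comb b p)) ^ s) := by
    intro j hjk
    rw [← exp_neg_mul_logRatio (hpos j) (hpos k)]
    by_cases hj : j ∈ I
    · simp only [balanceMap, if_neg hjk, if_pos hj]
      have h1 : 0 < ζ j / ζ k := div_pos (hζ j) (hζ k)
      have h2 := hpI k hk
      have h3 := hpI j hj
      have h4 : p j = p k * (ζ j / ζ k) * Real.exp (-(s * logRatio b h j k p)) ↔
          Real.log (p j) = Real.log (p k) + Real.log (ζ j / ζ k) - s * logRatio b h j k p := by
        have h5 : Real.log (p k * (ζ j / ζ k) * Real.exp (-(s * logRatio b h j k p))) =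
            Real.log (p k) + Real.log (ζ j / ζ k) - s * logRatio b h j k p := by
          rw [Real.log_mul (by positivity) (by positivity), Real.log_mul h2.ne' h1.ne',
            Real.log_exp]
          ring
        rw [← h5]
        constructor
        · intro h6
          exact congrArg Real.log h6
        · intro h6
          exact Real.log_injOn_pos h3 (mem_Ioi.2 (by positivity)) h6
      rw [h4, sub_eq_zero, eq_inv_mul_iff_mul_eq₀ hs.ne']
      constructor <;> intro h6 <;> linarith
    · simp only [balanceMap, if_neg hjk, if_neg hj]
      have h1 := hlog j hj
      have h2 : 0 < s⁻¹ * (logRatio b h j k p)⁻¹ := by positivity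
      rw [sub_eq_zero, expNegInvGlue, if_neg h2.not_ge, mul_inv, inv_inv, inv_inv]
  constructor
  · intro h0
    refine ⟨?_, fun j => ?_⟩
    · have := congrFun h0 k
      simp only [balanceMap, if_true, Pi.zero_apply] at this
      linarith
    · by_cases hjk : j = k
      · subst hjk
        rw [div_self (hζ j).ne', div_self (hpos j).ne', Real.one_rpow, mul_one, mul_one]
      · exact (hj j hjk).1 (congrFun h0 j)
  · rintro ⟨h1, h2⟩
    funext j
    by_cases hjk : j = k
    · simp [balanceMap, hjk, h1]
    · exact (hj j hjk).2 (h2 j)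

theorem exists_nhds_existsUnique_balanced [Nonempty ι] (hζ : ∀ i, 0 < ζ i)
    (hp : IsEffectiveWeight b h I p₀) (hind : AffineIndependent ℝ fun i : I => b i)
    (hpos : ∀ i, 0 < powerDist b h i (comb b p₀)) :
    (∃ U ∈ 𝓝 p₀, ∀ᶠ s in atTop, ∀ v ∈ balanced b h ζ s, ∀ v' ∈ balanced b h ζ s,
      weight b h ζ s v ∈ U → weight b h ζ s v' ∈ U → v = v') ∧
    ∀ U ∈ 𝓝 p₀, ∀ᶠ s in atTop, ∃ v ∈ balanced b h ζ s, weight b h ζ s v ∈ U := by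
  obtain ⟨k, hk⟩ : I.Nonempty := hp.min ▸ minimizers_nonempty b h _
  obtain ⟨A, hA, hA1, hA2, hA3⟩ := hasStrictFDerivAt_balanceMap (ζ := ζ) hk hp hpos
  -- A kernel vector is supported on `I` with sum zero, so `comb b q` is in the span of the
  -- differences of `b(I)`; the remaining rows make it orthogonal to them.
  have hker : ∀ q, A (0, q) = 0 → q = 0 := by
    intro q hq
    have h1 : ∀ i ∉ I, q i = 0 := fun i hi => by rw [← hA3 q i hi, hq, Pi.zero_apply]
    have h2 : ∑ i, q i = 0 := by rw [← hA1 q, hq, Pi.zero_apply]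
    have h3 : ∀ i ∈ I, inner ℝ (comb b q) (b k - b i) = 0 := by
      intro i hi
      by_cases hik : i = k
      · simp [hik]
      · have h4 := hA2 q i hi hik
        rw [hq, Pi.zero_apply, eq_comm, div_eq_zero_iff, or_iff_left (hpos k).ne'] at h4
        rw [real_inner_comm]
        linarith
    refine eq_zero_of_affineIndependent hind h1 h2 ?_
    rw [← inner_self_eq_zero (𝕜 := ℝ)]
    refine inner_comb_eq_zero h1 h2 fun i hi j hj => ?_
    rw [← sub_sub_sub_cancel_left (b j) (b i) (b k), inner_sub_right, h3 j hj, h3 i hi, sub_self]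
  obtain ⟨⟨U, hU, huniq⟩, hex⟩ :=
    existsUnique_zero_of_hasStrictFDerivAt hA (balanceMap_zero hk hp) hker
  have hcont : ∀ i, Continuous fun p => powerDist b h i (comb b p) := fun i =>
    (continuous_powerDist b h i).comp (continuous_comb b)
  have hV : ∀ᶠ p in 𝓝 p₀, (∀ i ∈ I, 0 < p i) ∧ (∀ i, 0 < powerDist b h i (comb b p)) ∧
      ∀ j ∉ I, 0 < logRatio b h j k p := by
    have h1 : ∀ᶠ p in 𝓝 p₀, ∀ i, 0 < powerDist b h i (comb b p) :=
      eventually_all.2 fun i => (hcont i).continuousAt.eventually (lt_mem_nhds (hpos i))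
    have h2 : ∀ᶠ p in 𝓝 p₀, ∀ i, i ∈ I → 0 < p i := by
      refine eventually_all.2 fun i => eventually_imp_distrib_left.2 fun hi => ?_
      exact (continuous_apply i).continuousAt.eventually (lt_mem_nhds (hp.pos i hi))
    have h3 : ∀ᶠ p in 𝓝 p₀, ∀ j, j ∉ I →
        powerDist b h k (comb b p) < powerDist b h j (comb b p) := by
      refine eventually_all.2 fun j => eventually_imp_distrib_left.2 fun hj => ?_
      exact (hcont k).continuousAt.eventually_lt (hcont j).continuousAt
        (powerDist_lt_of_notMem_minimizers (by rwa [hp.min]) (by rwa [hp.min]))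
    filter_upwards [h1, h2, h3] with p q1 q2 q3
    exact ⟨q2, q1, fun j hj => sub_pos.2 (Real.log_lt_log (q1 k) (q3 j hj))⟩
  constructor
  · refine ⟨_, inter_mem hU hV, ?_⟩
    filter_upwards [tendsto_inv_atTop_zero.eventually huniq, eventually_gt_atTop 0] with s hs hs0
      v hv v' hv' hvU hvU'
    have h1 : ∀ w ∈ balanced b h ζ s, weight b h ζ s w ∈ {p | (∀ i ∈ I, 0 < p i) ∧
        (∀ i, 0 < powerDist b h i (comb b p)) ∧ ∀ j ∉ I, 0 < logRatio b h j k p} →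
        balanceMap b h ζ I k (s⁻¹, weight b h ζ s w) = 0 := by
      rintro w ⟨hw1, hw2⟩ ⟨q1, q2, q3⟩
      refine (balanceMap_eq_zero_iff hk hζ hs0 q1 q2 q3).2 ⟨sum_weight hζ hw1, fun j => ?_⟩
      rw [hw2]
      exact weight_div hζ hw1 j k
    have h2 := hs _ hvU.1 _ hvU'.1 (h1 v hv hvU.2) (h1 v' hv' hvU'.2)
    rw [← hv.2, ← hv'.2, h2]
  · intro U' hU'
    filter_upwards [tendsto_inv_atTop_zero.eventually (hex _ (inter_mem hU' hV)),
      eventually_gt_atTop 0] with s hs hs0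
    obtain ⟨p, ⟨hp1, q1, q2, q3⟩, hp3⟩ := hs
    obtain ⟨h1, h2⟩ := (balanceMap_eq_zero_iff hk hζ hs0 q1 q2 q3).1 hp3
    have h3 := weight_eq_of_ratio hζ q2 h1 k h2
    exact ⟨comb b p, ⟨q2, by rw [h3]⟩, by rwa [h3]⟩

end LocalSolution

/-! ### Accumulation of balanced points as the exponent grows -/

section Localization

variable {E : Type*} [NormedAddCommGroup E] [InnerProductSpace ℝ E] {ι : Type*} [Fintype ι]
  {b : ι → E} {h ζ : ι → ℝ}

theorem comb_sub_eq_sum {p : ι → ℝ} (hp : ∑ i, p i = 1) (x : E) :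
    comb b p - x = ∑ j, p j • (b j - x) := by
  simp only [smul_sub, Finset.sum_sub_distrib, ← Finset.sum_smul, hp, one_smul, comb_apply]

theorem weight_le_one [Nonempty ι] (hζ : ∀ i, 0 < ζ i) {s : ℝ} {v : E}
    (hv : ∀ i, 0 < powerDist b h i v) (i : ι) : weight b h ζ s v i ≤ 1 := by
  rw [← sum_weight (s := s) hζ hv]
  exact Finset.single_le_sum (f := weight b h ζ s v) (fun j _ => (weight_pos hζ hv j).le)
    (Finset.mem_univ i)

/-- Used with `q < 1`, this is the exponential decay in `s` of the weights of non-minimizers. -/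
theorem weight_le_mul_rpow [Nonempty ι] (hζ : ∀ i, 0 < ζ i) {s q : ℝ} (hs : 0 ≤ s) {v : E}
    (hv : ∀ i, 0 < powerDist b h i v) {i j : ι} (hq : powerDist b h i v ≤ q * powerDist b h j v) :
    weight b h ζ s v j ≤ ζ j / ζ i * q ^ s := by
  rw [weight_div hζ hv j i]
  have h1 : (powerDist b h i v / powerDist b h j v) ^ s ≤ q ^ s :=
    Real.rpow_le_rpow (div_pos (hv i) (hv j)).le ((div_le_iff₀ (hv j)).2 hq) hs
  have h2 : 0 < ζ j / ζ i := div_pos (hζ j) (hζ i)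
  have h3 : 0 ≤ (powerDist b h i v / powerDist b h j v) ^ s :=
    Real.rpow_nonneg (div_pos (hv i) (hv j)).le s
  calc _ ≤ 1 * (ζ j / ζ i) * (powerDist b h i v / powerDist b h j v) ^ s := by
        gcongr
        exact weight_le_one hζ hv i
    _ ≤ _ := by
        rw [one_mul]
        gcongr

/-- A ratio strictly between `0` and `1` that bounds `ρ_i / ρ_j` near a point where
`ρ_i < ρ_j`. -/
theorem exists_eventually_powerDist_le_mul (hh : ∀ i, 0 ≤ h i) {i j : ι} {v : E}
    (hij : powerDist b h i v < powerDist b h j v) :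
    ∃ q : ℝ, 0 < q ∧ q < 1 ∧ ∀ᶠ w in 𝓝 v, powerDist b h i w ≤ q * powerDist b h j w := by
  have hj : 0 < powerDist b h j v := (powerDist_nonneg hh i v).trans_lt hij
  obtain ⟨q, hq1, hq2⟩ := exists_between ((div_lt_one hj).2 hij)
  refine ⟨q, (div_nonneg (powerDist_nonneg hh i v) hj.le).trans_lt hq1, hq2, ?_⟩
  have h1 : ∀ᶠ w in 𝓝 v, powerDist b h i w < q * powerDist b h j w :=
    (continuous_powerDist b h i).continuousAt.eventually_lt
      ((continuous_powerDist b h j).const_mul q).continuousAt ((div_lt_iff₀ hj).1 hq1)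
  exact h1.mono fun w hw => hw.le

/-- No balanced point lies near a singularity of the energy. -/
theorem eventually_notMem_balanced [Nonempty ι] (hζ : ∀ i, 0 < ζ i) {i : ι} (hi : h i = 0)
    (hj : ∀ j ≠ i, 0 < powerDist b h j (b i)) :
    ∀ᶠ v in 𝓝 (b i), ∀ s : ℝ, 1 ≤ s → v ∉ balanced b h ζ s := by
  have hρ : ∀ v, powerDist b h i v = ‖v - b i‖ ^ 2 := fun v => by simp [powerDist, hi]
  -- Near `b i` one has `ρ_j > ρ_j(b i) / 2`, hence `ρ_i ≤ |v - b i|² C_j ρ_j`.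
  let C : ι → ℝ := fun j => 2 / powerDist b h j (b i)
  let K : ℝ := ∑ j, ζ j / ζ i * C j * ‖b j - b i‖
  have h1 : ∀ᶠ v in 𝓝 (b i), ∀ j, j ≠ i → powerDist b h j (b i) / 2 < powerDist b h j v := by
    refine eventually_all.2 fun j => eventually_imp_distrib_left.2 fun hji => ?_
    exact (continuous_powerDist b h j).continuousAt.eventually
      (lt_mem_nhds (half_lt_self (hj j hji)))
  have hn : Tendsto (fun v : E => ‖v - b i‖) (𝓝 (b i)) (𝓝 0) := by
    have : Continuous fun v : E => ‖v - b i‖ := by fun_prop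
    simpa using this.tendsto (b i)
  have h2 : ∀ᶠ v in 𝓝 (b i), ∀ j, j ≠ i → ‖v - b i‖ ^ 2 * C j < 1 := by
    refine eventually_all.2 fun j => eventually_imp_distrib_left.2 fun _ => ?_
    have : Tendsto (fun v : E => ‖v - b i‖ ^ 2 * C j) (𝓝 (b i)) (𝓝 0) := by
      simpa using (hn.pow 2).mul_const (C j)
    exact this.eventually (gt_mem_nhds one_pos)
  have h3 : ∀ᶠ v in 𝓝 (b i), K * ‖v - b i‖ < 1 := by
    have : Tendsto (fun v : E => K * ‖v - b i‖) (𝓝 (b i)) (𝓝 0) := by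
      simpa using hn.const_mul K
    exact this.eventually (gt_mem_nhds one_pos)
  filter_upwards [h1, h2, h3] with v q1 q2 q3 s hs ⟨hv1, hv2⟩
  have hσ : 0 < ‖v - b i‖ := by
    have := hv1 i
    rw [hρ] at this
    by_contra hc
    rw [le_antisymm (not_lt.1 hc) (norm_nonneg _)] at this
    norm_num at this
  have hw : ∀ j, j ≠ i → weight b h ζ s v j ≤ ζ j / ζ i * (‖v - b i‖ ^ 2 * C j) := by
    intro j hji
    have hC : 0 ≤ ‖v - b i‖ ^ 2 * C j := by
      have := hj j hji
      positivity
    refine (weight_le_mul_rpow (i := i) (q := ‖v - b i‖ ^ 2 * C j) hζ (by linarith) hv1 ?_).trans ?_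
    · rw [hρ, mul_assoc]
      refine le_mul_of_one_le_right (sq_nonneg _) ?_
      have h4 := hj j hji
      rw [div_mul_eq_mul_div, one_le_div h4]
      linarith [q1 j hji]
    · have := (div_pos (hζ j) (hζ i)).le
      gcongr
      calc _ ≤ (‖v - b i‖ ^ 2 * C j) ^ (1 : ℝ) :=
            Real.rpow_le_rpow_of_exponent_ge_of_imp hC (q2 j hji).le hs (by intros; linarith)
        _ = _ := Real.rpow_one _
  -- The other weights are `O(|v - b i|²)`, since `s ≥ 1` and the base of the power is below `1`.
  -- The balance equation then contradicts `K |v - b i| < 1`.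
  have hle : ‖v - b i‖ ≤ K * ‖v - b i‖ ^ 2 := by
    calc ‖v - b i‖ = ‖∑ j, weight b h ζ s v j • (b j - b i)‖ := by
          rw [← comb_sub_eq_sum (sum_weight hζ hv1), hv2]
      _ ≤ ∑ j, ‖weight b h ζ s v j • (b j - b i)‖ := norm_sum_le _ _
      _ ≤ ∑ j, ζ j / ζ i * C j * ‖b j - b i‖ * ‖v - b i‖ ^ 2 := by
          refine Finset.sum_le_sum fun j _ => ?_
          rw [norm_smul, Real.norm_of_nonneg (weight_pos hζ hv1 j).le]
          by_cases hji : j = i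
          · simp [hji]
          · calc _ ≤ ζ j / ζ i * (‖v - b i‖ ^ 2 * C j) * ‖b j - b i‖ := by
                  gcongr
                  exact hw j hji
              _ = _ := by ring
      _ = K * ‖v - b i‖ ^ 2 := by rw [← Finset.sum_mul]
  nlinarith

/-- The sets of minimizers that give rise to a critical point: the minimizers of some point of
their convex hull, the singularities of the energy being left out. -/
def effectiveIndices (b : ι → E) (h : ι → ℝ) : Set (Set ι) :=
  {I | (∃ v, minimizers b h v = I ∧ v ∈ convexHull ℝ (b '' I)) ∧ (1 < I.encard ∨ ∀ i ∈ I, h i ≠ 0)}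

/-- A vanishing power distance is minimal, so all those with indices in `I` vanish: either two of
the independent points coincide, or a height that is nonzero by assumption is zero. -/
theorem powerDist_pos_of_mem_effectiveIndices (hh : ∀ i, 0 ≤ h i) {I : Set ι}
    (hI : I ∈ effectiveIndices b h) (hind : AffineIndependent ℝ fun i : I => b i) {v : E}
    (hv : minimizers b h v = I) (i : ι) : 0 < powerDist b h i v := by
  have : Nonempty ι := ⟨i⟩
  refine lt_of_le_of_ne (powerDist_nonneg hh i v) fun h0 => ?_
  have hzero : ∀ j, powerDist b h j v = 0 → v = b j ∧ h j = 0 := by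
    intro j hj
    have h1 := hh j
    have h2 := sq_nonneg ‖v - b j‖
    rw [powerDist] at hj
    refine ⟨?_, by linarith⟩
    have h3 : ‖v - b j‖ ^ 2 = 0 := by linarith
    exact sub_eq_zero.1 (norm_eq_zero.1 (pow_eq_zero_iff two_ne_zero |>.1 h3))
  have hiI : i ∈ I := by
    rw [← hv]
    intro j
    rw [← h0]
    exact powerDist_nonneg hh j v
  rcases hI.2 with h1 | h1
  · obtain ⟨j, k, hj, hk, hjk⟩ := one_lt_encard_iff.1 h1
    have hz : ∀ l ∈ I, powerDist b h l v = 0 := fun l hl => by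
      rw [h0]
      exact powerDist_eq_of_mem_minimizers (by rwa [hv]) (by rwa [hv])
    have h2 : b j = b k := (hzero j (hz j hj)).1.symm.trans (hzero k (hz k hk)).1
    have h3 := hind.injective (a₁ := ⟨j, hj⟩) (a₂ := ⟨k, hk⟩) h2
    exact absurd (congrArg Subtype.val h3) hjk
  · exact h1 i hiI (hzero i h0.symm).2

/-- For large exponents, the weights of every balanced point are near an effective weight. -/
theorem eventually_weight_mem [Nonempty ι] (hh : ∀ i, 0 ≤ h i) (hζ : ∀ i, 0 < ζ i)
    (hgen : IsPowerGeneric b h) {U : Set ι → Set (ι → ℝ)}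
    (hU : ∀ I ∈ effectiveIndices b h, ∀ p, IsEffectiveWeight b h I p → U I ∈ 𝓝 p) :
    ∀ᶠ s in atTop, ∀ v ∈ balanced b h ζ s, ∃ I ∈ effectiveIndices b h, weight b h ζ s v ∈ U I := by
  -- A failure for arbitrarily large `s` gives a sequence of balanced points; a limit `p` of their
  -- weights in the simplex is shown to be effective, or the limit point to be a singularity.
  by_contra hcon
  obtain ⟨s, hs, hns⟩ := exists_seq_forall_of_frequently (not_eventually.1 hcon)
  push Not at hns
  choose v hv hvU using hns
  have hmem : ∀ n, weight b h ζ (s n) (v n) ∈ stdSimplex ℝ ι := fun n =>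
    ⟨fun i => (weight_pos hζ (hv n).1 i).le, sum_weight hζ (hv n).1⟩
  obtain ⟨p, ⟨hp0, hp1⟩, φ, hφ, hlim⟩ := (isCompact_stdSimplex ℝ ι).tendsto_subseq hmem
  have hsφ : Tendsto (s ∘ φ) atTop atTop := hs.comp hφ.tendsto_atTop
  have hvlim : Tendsto (v ∘ φ) atTop (𝓝 (comb b p)) := by
    refine (((continuous_comb b).tendsto p).comp hlim).congr fun n => ?_
    exact (hv (φ n)).2
  set I := minimizers b h (comb b p) with hI
  obtain ⟨hind, -⟩ := hgen (comb b p)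
  obtain ⟨i, hi⟩ := minimizers_nonempty b h (comb b p)
  have hzero : ∀ j ∉ I, p j = 0 := by
    intro j hj
    obtain ⟨q, hq0, hq1, hq⟩ := exists_eventually_powerDist_le_mul hh
      (powerDist_lt_of_notMem_minimizers hi hj)
    have h1 : Tendsto (fun n => ζ j / ζ i * q ^ (s ∘ φ) n) atTop (𝓝 0) := by
      simpa using ((tendsto_rpow_atTop_of_base_lt_one q (by linarith) hq1).comp hsφ).const_mul
        (ζ j / ζ i)
    have h2 : Tendsto (fun n => weight b h ζ (s (φ n)) (v (φ n)) j) atTop (𝓝 (p j)) :=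
      ((continuous_apply j).tendsto p).comp hlim
    refine tendsto_nhds_unique h2 (squeeze_zero' ?_ ?_ h1)
    · exact .of_forall fun n => (weight_pos hζ (hv (φ n)).1 j).le
    · filter_upwards [hvlim.eventually hq, hsφ.eventually_ge_atTop 0] with n hn hn0
      exact weight_le_mul_rpow hζ hn0 (hv (φ n)).1 hn
  have hconv := comb_mem_convexHull_image b I hp0 hzero hp1
  by_cases hIE : 1 < I.encard ∨ ∀ i ∈ I, h i ≠ 0
  · have hIeff : I ∈ effectiveIndices b h := ⟨⟨comb b p, rfl, hconv⟩, hIE⟩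
    obtain ⟨p', hp', hpp'⟩ := exists_isEffectiveWeight hgen hconv
    have : p = p' := eq_of_minimizers_comb_eq hind hzero hp'.zero hp1 hp'.sum rfl hp'.min
    obtain ⟨n, hn⟩ := (hlim.eventually (hU I hIeff p (this ▸ hp'))).exists
    exact hvU (φ n) I hIeff hn
  -- Here `I = {i'}` with `h i' = 0`, so the balanced points converge to the singularity `b i'`.
  · push Not at hIE
    obtain ⟨h1, i', hi', h2⟩ := hIE
    have h3 : ∀ j ∈ I, j = i' := fun j hj => encard_le_one_iff.1 h1 j i' hj hi'
    have h4 : ∀ j, j ≠ i' → p j = 0 := fun j hj => hzero j fun hjI => hj (h3 j hjI)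
    have h5 : comb b p = b i' := by
      have h6 : p i' = 1 := by
        rw [← hp1, Finset.sum_eq_single i' (fun j _ hj => h4 j hj) (by simp)]
      rw [comb_apply, Finset.sum_eq_single i' (fun j _ hj => by rw [h4 j hj, zero_smul]) (by simp),
        h6, one_smul]
    have h7 : ∀ j ≠ i', 0 < powerDist b h j (b i') := fun j hj =>
      (powerDist_nonneg hh i' _).trans_lt (powerDist_lt_of_notMem_minimizers (by rwa [← h5])
        fun hjI => hj (h3 j (by rwa [hI, h5])))
    have h8 := eventually_notMem_balanced hζ h2 h7
    rw [h5] at hvlim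
    obtain ⟨n, hn, hn1⟩ := ((hvlim.eventually h8).and (hsφ.eventually_ge_atTop 1)).exists
    exact hn _ hn1 (hv (φ n))

end Localization

/-! ### Sign of the Hessian at balanced points -/

section HessianSigns

variable {E : Type*} [NormedAddCommGroup E] [InnerProductSpace ℝ E] {ι : Type*} [Fintype ι]
  {b : ι → E} {h ζ : ι → ℝ} {I : Set ι} {p₀ : ι → ℝ}

/-- The quadratic form `∑ i, p i ⟨v - b i, u⟩² / ρ_i(v)` at the combination `v` of the `b i` with
coefficients `p`. -/
def spread (b : ι → E) (h : ι → ℝ) (p : ι → ℝ) (u : E) : ℝ :=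
  ∑ i, p i * (inner ℝ (comb b p - b i) u ^ 2 / powerDist b h i (comb b p))

theorem hessian_energy_eq_spread [Nonempty ι] (hh : ∀ i, 0 ≤ h i) (hζ : ∀ i, 0 < ζ i) (α : ℝ)
    {v : E} (hv : v ∈ balanced b h ζ (α + 1)) (u : E) :
    hessian (energy b h ζ α) v u u =
      2 * α * (∑ j, ζ j * powerDist b h j v ^ (-(α + 1))) *
        (2 * (α + 1) * spread b h (weight b h ζ (α + 1) v) u - ‖u‖ ^ 2) := by
  obtain ⟨hv1, hv2⟩ := hv
  have hW := (sum_weightTerm_pos (s := α + 1) hζ hv1).ne'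
  rw [hessian_energy hh ζ α hv1, mul_assoc (2 * α)]
  congr 1
  have h1 : (∑ j, ζ j * powerDist b h j v ^ (-(α + 1))) * ‖u‖ ^ 2 =
      ∑ j, ζ j * powerDist b h j v ^ (-(α + 1)) * ‖u‖ ^ 2 := Finset.sum_mul _ _ _
  rw [mul_sub, h1, spread, hv2, Finset.mul_sum, Finset.mul_sum, ← Finset.sum_sub_distrib]
  refine Finset.sum_congr rfl fun i _ => ?_
  have h2 := (hv1 i).ne'
  rw [weight, real_inner_self_eq_norm_sq]
  field_simp

theorem inner_comb_sub_le {p : ι → ℝ} (hp0 : ∀ i, 0 ≤ p i) (hp1 : ∑ i, p i = 1) {M : ℝ}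
    (hM : ∀ i j, ‖b i - b j‖ ≤ M) (i : ι) (u : E) : |inner ℝ (comb b p - b i) u| ≤ M * ‖u‖ := by
  refine (abs_real_inner_le_norm _ _).trans (mul_le_mul_of_nonneg_right ?_ (norm_nonneg u))
  rw [comb_sub_eq_sum hp1]
  calc _ ≤ ∑ j, ‖p j • (b j - b i)‖ := norm_sum_le _ _
    _ ≤ ∑ j, p j * M := Finset.sum_le_sum fun j _ => by
        rw [norm_smul, Real.norm_of_nonneg (hp0 j)]
        exact mul_le_mul_of_nonneg_left (hM j i) (hp0 j)
    _ = M := by rw [← Finset.sum_mul, hp1, one_mul]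

/-- In `⟨v - b i, u⟩ = ∑ p_j ⟨b_j - b_i, u⟩` the terms with `j ∈ I` vanish, and the others carry
weights at most `ε`. -/
theorem inner_comb_sub_le_of_orthogonal {p : ι → ℝ} (hp0 : ∀ i, 0 ≤ p i) (hp1 : ∑ i, p i = 1)
    {M ε : ℝ} (hM : ∀ i j, ‖b i - b j‖ ≤ M) (hε : ∀ j ∉ I, p j ≤ ε) (hε0 : 0 ≤ ε) {u : E}
    (hu : ∀ i ∈ I, ∀ j ∈ I, inner ℝ (b i - b j) u = 0) {i : ι} (hi : i ∈ I) :
    |inner ℝ (comb b p - b i) u| ≤ Fintype.card ι * ε * (M * ‖u‖) := by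
  have hM0 : 0 ≤ M := (norm_nonneg _).trans (hM i i)
  rw [comb_sub_eq_sum hp1, sum_inner]
  calc _ ≤ ∑ j, |inner ℝ (p j • (b j - b i)) u| := Finset.abs_sum_le_sum_abs _ _
    _ ≤ ∑ _j : ι, ε * (M * ‖u‖) := Finset.sum_le_sum fun j _ => by
        rw [real_inner_smul_left, abs_mul, abs_of_nonneg (hp0 j)]
        by_cases hj : j ∈ I
        · rw [hu j hj i hi, abs_zero, mul_zero]
          positivity
        · refine mul_le_mul (hε j hj) ?_ (abs_nonneg _) hε0
          exact (abs_real_inner_le_norm _ _).trans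
            (mul_le_mul_of_nonneg_right (hM j i) (norm_nonneg u))
    _ = _ := by
        rw [Finset.sum_const, Finset.card_univ, nsmul_eq_mul]
        ring

theorem tendsto_mul_rpow_atTop {q : ℝ} (hq0 : 0 < q) (hq1 : q < 1) :
    Tendsto (fun s : ℝ => s * q ^ s) atTop (𝓝 0) := by
  have hc : 0 < -Real.log q := neg_pos.2 (Real.log_neg hq0 hq1)
  have h1 := (Real.tendsto_pow_mul_exp_neg_atTop_nhds_zero 1).comp
    (tendsto_id.const_mul_atTop hc)
  have h2 := h1.const_mul (-Real.log q)⁻¹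
  rw [mul_zero] at h2
  refine h2.congr fun s => ?_
  simp only [Function.comp_apply, id, pow_one]
  rw [Real.rpow_def_of_pos hq0, ← mul_assoc, inv_mul_cancel_left₀ hc.ne']
  congr 2
  ring

/-- Off `I` the weights are `O(q ^ s)` with `q < 1`, which absorbs the factor `s` of the Hessian. -/
theorem eventually_mul_weight_le [Nonempty ι] (hh : ∀ i, 0 ≤ h i) (hζ : ∀ i, 0 < ζ i)
    (hp : IsEffectiveWeight b h I p₀) {ε : ℝ} (hε : 0 < ε) :
    ∀ᶠ x : ℝ × (ι → ℝ) in atTop ×ˢ 𝓝 p₀, ∀ v ∈ balanced b h ζ x.1, weight b h ζ x.1 v = x.2 →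
      ∀ j ∉ I, x.1 * x.2 j ≤ ε := by
  obtain ⟨k, hk⟩ : I.Nonempty := hp.min ▸ minimizers_nonempty b h _
  have h1 : ∀ᶠ x : ℝ × (ι → ℝ) in atTop ×ˢ 𝓝 p₀, ∀ j, j ∉ I → ∀ v ∈ balanced b h ζ x.1,
      weight b h ζ x.1 v = x.2 → x.1 * x.2 j ≤ ε := by
    refine eventually_all.2 fun j => eventually_imp_distrib_left.2 fun hj => ?_
    obtain ⟨q, hq0, hq1, hq⟩ := exists_eventually_powerDist_le_mul (i := k) (j := j)
      (v := comb b p₀) hh (powerDist_lt_of_notMem_minimizers (by rwa [hp.min]) (by rwa [hp.min]))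
    have h2 : Tendsto (fun s : ℝ => ζ j / ζ k * (s * q ^ s)) atTop (𝓝 0) := by
      simpa using (tendsto_mul_rpow_atTop hq0 hq1).const_mul (ζ j / ζ k)
    have h3 : ∀ᶠ s : ℝ in atTop, 0 ≤ s ∧ ζ j / ζ k * (s * q ^ s) < ε :=
      (eventually_ge_atTop 0).and (h2.eventually (gt_mem_nhds hε))
    filter_upwards [h3.prod_mk (((continuous_comb b).tendsto p₀).eventually hq)] with x hx v hv hvx
    obtain ⟨⟨hs0, hs1⟩, hx2⟩ := hx
    rw [← hvx, hv.2] at hx2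
    have h4 := weight_le_mul_rpow (ζ := ζ) hζ hs0 hv.1 hx2
    rw [hvx] at h4
    calc x.1 * x.2 j ≤ x.1 * (ζ j / ζ k * q ^ x.1) := mul_le_mul_of_nonneg_left h4 hs0
      _ = ζ j / ζ k * (x.1 * q ^ x.1) := by ring
      _ ≤ ε := hs1.le
  filter_upwards [h1] with x hx v hv hvx j hj using hx j hj v hv hvx

theorem inner_eq_zero_of_mem_vectorSpan_orthogonal {u : E}
    (hu : u ∈ (vectorSpan ℝ (b '' I))ᗮ) : ∀ i ∈ I, ∀ j ∈ I, inner ℝ (b i - b j) u = 0 := by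
  intro i hi j hj
  exact hu _ (vsub_mem_vectorSpan ℝ (mem_image_of_mem b hi) (mem_image_of_mem b hj))

theorem mem_vectorSpan_orthogonal {u : E}
    (hu : ∀ i ∈ I, ∀ j ∈ I, inner ℝ (b i - b j) u = 0) : u ∈ (vectorSpan ℝ (b '' I))ᗮ := by
  rw [vectorSpan, Submodule.mem_orthogonal]
  intro w hw
  induction hw using Submodule.span_induction with
  | mem x hx =>
    obtain ⟨_, ⟨i, hi, rfl⟩, _, ⟨j, hj, rfl⟩, rfl⟩ := hx
    exact hu i hi j hj
  | zero => exact inner_zero_left _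
  | add x y _ _ hx hy => rw [inner_add_left, hx, hy, add_zero]
  | smul a x _ hx => rw [inner_smul_left, hx, mul_zero]

theorem eventually_spread_lt [Nonempty ι] (hh : ∀ i, 0 ≤ h i) (hζ : ∀ i, 0 < ζ i)
    (hp : IsEffectiveWeight b h I p₀) (hpos : ∀ i, 0 < powerDist b h i (comb b p₀)) :
    ∀ᶠ x : ℝ × (ι → ℝ) in atTop ×ˢ 𝓝 p₀, ∀ v ∈ balanced b h ζ x.1, weight b h ζ x.1 v = x.2 →
      ∀ u ∈ (vectorSpan ℝ (b '' I))ᗮ, u ≠ 0 → 2 * x.1 * spread b h x.2 u < ‖u‖ ^ 2 := by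
  obtain ⟨M, hM⟩ : ∃ M, ∀ i j, ‖b i - b j‖ ≤ M := by
    obtain ⟨M, hM⟩ := (finite_range fun x : ι × ι => ‖b x.1 - b x.2‖).bddAbove
    exact ⟨M, fun i j => hM ⟨(i, j), rfl⟩⟩
  obtain ⟨r, hr0, hr⟩ : ∃ r, 0 < r ∧ ∀ i, r < powerDist b h i (comb b p₀) := by
    obtain ⟨i, hi⟩ := minimizers_nonempty b h (comb b p₀)
    exact ⟨_, half_pos (hpos i), fun j => (half_lt_self (hpos i)).trans_le (hi j)⟩
  set N : ℝ := (Fintype.card ι : ℝ) with hN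
  have hN1 : 1 ≤ N := by
    rw [hN, Nat.one_le_cast]
    exact Fintype.card_pos
  -- `ε` is dictated by the final estimate: one factor `N` comes from the sum over `i`, the other
  -- from the sum bounding a single inner product.
  obtain ⟨ε, hε0, hε⟩ : ∃ ε, 0 < ε ∧ 2 * (N * (N * ε * M ^ 2 / r)) < 1 := by
    have h1 : Tendsto (fun ε : ℝ => 2 * (N * (N * ε * M ^ 2 / r))) (𝓝 0) (𝓝 0) := by
      have : Continuous (fun ε : ℝ => 2 * (N * (N * ε * M ^ 2 / r))) := by fun_prop
      simpa using this.tendsto 0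
    obtain ⟨ε, h2, h3⟩ := (((h1.eventually (gt_mem_nhds one_pos)).filter_mono
      nhdsWithin_le_nhds).and (self_mem_nhdsWithin : Ioi (0 : ℝ) ∈ 𝓝[>] 0)).exists
    exact ⟨ε, h3, h2⟩
  have hrx : ∀ᶠ p in 𝓝 p₀, ∀ i, r < powerDist b h i (comb b p) :=
    eventually_all.2 fun i => ((continuous_powerDist b h i).comp
      (continuous_comb b)).continuousAt.eventually (lt_mem_nhds (hr i))
  filter_upwards [eventually_mul_weight_le hh hζ hp hε0, (eventually_gt_atTop 0).prod_mk hrx]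
    with x hx1 ⟨hs, hx2⟩ v hv hvx u hu hu0
  have hεx := hx1 v hv hvx
  have hp0 : ∀ i, 0 ≤ x.2 i := fun i => by rw [← hvx]; exact (weight_pos hζ hv.1 i).le
  have hp1 : ∑ i, x.2 i = 1 := by rw [← hvx]; exact sum_weight hζ hv.1
  have hple : ∀ i, x.2 i ≤ 1 := fun i => by rw [← hvx]; exact weight_le_one hζ hv.1 i
  have hM0 : 0 ≤ M := (norm_nonneg _).trans (hM (Classical.arbitrary ι) (Classical.arbitrary ι))
  have hin := inner_comb_sub_le (b := b) hp0 hp1 hM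
  have hin2 := fun i hi => inner_comb_sub_le_of_orthogonal (I := I) (ε := ε / x.1) (i := i) hp0 hp1
    hM (fun j hj => (le_div_iff₀' hs).2 (hεx j hj)) (by positivity)
    (inner_eq_zero_of_mem_vectorSpan_orthogonal hu) hi
  have hterm : ∀ i, x.1 * (x.2 i * (inner ℝ (comb b x.2 - b i) u ^ 2 /
      powerDist b h i (comb b x.2))) ≤ N * ε * M ^ 2 / r * ‖u‖ ^ 2 := by
    intro i
    have h2 : x.1 * (x.2 i * inner ℝ (comb b x.2 - b i) u ^ 2) ≤ N * ε * M ^ 2 * ‖u‖ ^ 2 := by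
      rw [← sq_abs]
      -- For `i ∈ I` one of the two inner products carries the factor `ε / s`; for `i ∉ I` the
      -- weight itself is at most `ε / s`.
      by_cases hi : i ∈ I
      · calc _ ≤ x.1 * (1 * ((N * (ε / x.1) * (M * ‖u‖)) * (M * ‖u‖))) := by
              rw [sq]
              gcongr
              · exact hple i
              · exact hin2 i hi
              · exact hin i u
          _ = _ := by
              field_simp
      · calc _ = (x.1 * x.2 i) * |inner ℝ (comb b x.2 - b i) u| ^ 2 := by ring
          _ ≤ (N * ε) * (M * ‖u‖) ^ 2 :=
              mul_le_mul ((hεx i hi).trans (le_mul_of_one_le_left hε0.le hN1))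
                (pow_le_pow_left₀ (abs_nonneg _) (hin i u) 2) (sq_nonneg _) (by positivity)
          _ = _ := by ring
    calc _ = x.1 * (x.2 i * inner ℝ (comb b x.2 - b i) u ^ 2) / powerDist b h i (comb b x.2) := by
          ring
      _ ≤ N * ε * M ^ 2 * ‖u‖ ^ 2 / r := by
          gcongr
          exact (hx2 i).le
      _ = _ := by ring
  have hsum : x.1 * spread b h x.2 u ≤ N * (N * ε * M ^ 2 / r * ‖u‖ ^ 2) := by
    rw [spread, Finset.mul_sum, hN, ← nsmul_eq_mul, ← Finset.card_univ, ← Finset.sum_const]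
    exact Finset.sum_le_sum fun i _ => hterm i
  have hu2 : 0 < ‖u‖ ^ 2 := by positivity
  nlinarith

/-- If the sum vanished, `u` would be orthogonal to every `v - b i` with `i ∈ I`, hence to the
differences that span the space containing it. -/
theorem spread_pos (hp : IsEffectiveWeight b h I p₀)
    (hpos : ∀ i, 0 < powerDist b h i (comb b p₀)) {u : E} (hu : u ∈ vectorSpan ℝ (b '' I))
    (hu0 : u ≠ 0) : 0 < spread b h p₀ u := by
  have hp0 : ∀ i, 0 ≤ p₀ i := fun i => by
    by_cases hi : i ∈ I
    · exact (hp.pos i hi).le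
    · exact (hp.zero i hi).ge
  have hterm : ∀ i, 0 ≤ p₀ i * (inner ℝ (comb b p₀ - b i) u ^ 2 / powerDist b h i (comb b p₀)) :=
    fun i => mul_nonneg (hp0 i) (div_nonneg (sq_nonneg _) (hpos i).le)
  refine lt_of_le_of_ne (Finset.sum_nonneg fun i _ => hterm i) fun h0 => hu0 ?_
  have h1 : ∀ i ∈ I, inner ℝ (comb b p₀ - b i) u = 0 := by
    intro i hi
    have h2 := (Finset.sum_eq_zero_iff_of_nonneg fun i _ => hterm i).1 h0.symm i (Finset.mem_univ i)
    rw [mul_eq_zero, or_iff_right (hp.pos i hi).ne', div_eq_zero_iff,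
      or_iff_left (hpos i).ne'] at h2
    exact pow_eq_zero_iff two_ne_zero |>.1 h2
  have h3 : u ∈ (vectorSpan ℝ (b '' I))ᗮ := mem_vectorSpan_orthogonal fun i hi j hj => by
    rw [← sub_sub_sub_cancel_left (b j) (b i) (comb b p₀), inner_sub_left, h1 j hj, h1 i hi,
      sub_self]
  exact inner_self_eq_zero.1 (h3 u hu)

/-- After scaling to `|u| = 1` the claim is `1 / (2 s) < spread`. It holds near `(0, p₀)` by
positivity and continuity, uniformly on the compact unit sphere. -/
theorem eventually_lt_spread [FiniteDimensional ℝ E] (hp : IsEffectiveWeight b h I p₀)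
    (hpos : ∀ i, 0 < powerDist b h i (comb b p₀)) :
    ∀ᶠ x : ℝ × (ι → ℝ) in atTop ×ˢ 𝓝 p₀,
      ∀ u ∈ vectorSpan ℝ (b '' I), u ≠ 0 → ‖u‖ ^ 2 < 2 * x.1 * spread b h x.2 u := by
  have : ProperSpace E := FiniteDimensional.proper ℝ E
  have hK : IsCompact ((vectorSpan ℝ (b '' I) : Set E) ∩ Metric.sphere 0 1) :=
    (isCompact_sphere (0 : E) 1).inter_left (Submodule.closed_of_finiteDimensional _)
  have h1 : ∀ᶠ y : ℝ × (ι → ℝ) in 𝓝 (0, p₀), ∀ u ∈ (vectorSpan ℝ (b '' I) : Set E) ∩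
      Metric.sphere 0 1, y.1 < spread b h y.2 u := by
    refine hK.eventually_forall_of_forall_eventually fun u hu => ?_
    have hu0 : u ≠ 0 := by
      rintro rfl
      simpa using hu.2
    have hc : ContinuousAt (fun z : (ℝ × (ι → ℝ)) × E => spread b h z.1.2 z.2) ((0, p₀), u) := by
      unfold spread
      refine tendsto_finsetSum _ fun i _ => ?_
      have hcomb : Continuous fun z : (ℝ × (ι → ℝ)) × E => comb b z.1.2 :=
        (continuous_comb b).comp (continuous_snd.comp continuous_fst)
      refine ContinuousAt.mul ?_ (ContinuousAt.div ?_ ?_ (hpos i).ne')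
      · exact ((continuous_apply i).comp (continuous_snd.comp continuous_fst)).continuousAt
      · exact (((hcomb.sub continuous_const).inner continuous_snd).pow 2).continuousAt
      · exact ((continuous_powerDist b h i).comp hcomb).continuousAt
    exact ContinuousAt.eventually_lt (f := fun z : (ℝ × (ι → ℝ)) × E => z.1.1)
      (by fun_prop) hc (spread_pos hp hpos hu.1 hu0)
  have h2 : Tendsto (fun x : ℝ × (ι → ℝ) => ((2 * x.1)⁻¹, x.2)) (atTop ×ˢ 𝓝 p₀) (𝓝 (0, p₀)) := by
    rw [nhds_prod_eq]
    refine (tendsto_inv_atTop_zero.comp ?_).prodMk tendsto_snd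
    exact tendsto_fst.const_mul_atTop two_pos
  filter_upwards [h2.eventually h1, (eventually_gt_atTop (0 : ℝ)).prod_inl (𝓝 p₀)]
    with x hx hs u hu hu0
  have hn : 0 < ‖u‖ := norm_pos_iff.2 hu0
  have h3 := hx (‖u‖⁻¹ • u) ⟨Submodule.smul_mem _ _ hu, by simp [norm_smul, hn.ne']⟩
  have h4 : spread b h x.2 (‖u‖⁻¹ • u) = spread b h x.2 u / ‖u‖ ^ 2 := by
    rw [spread, spread, Finset.sum_div]
    refine Finset.sum_congr rfl fun i _ => ?_
    rw [real_inner_smul_right]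
    ring
  rw [h4] at h3
  rw [lt_div_iff₀ (by positivity), inv_mul_lt_iff₀ (by linarith)] at h3
  exact h3

/-- For large exponents, the Hessian of the energy at a balanced point with weights near an
effective weight is positive definite along the affine span of the minimizers and negative definite
orthogonally to it. -/
theorem eventually_hessian_sign [Nonempty ι] [FiniteDimensional ℝ E] (hh : ∀ i, 0 ≤ h i)
    (hζ : ∀ i, 0 < ζ i) (hp : IsEffectiveWeight b h I p₀)
    (hpos : ∀ i, 0 < powerDist b h i (comb b p₀)) :
    ∃ U ∈ 𝓝 p₀, ∀ᶠ s in atTop, ∀ v ∈ balanced b h ζ s, weight b h ζ s v ∈ U →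
      (∀ u ∈ vectorSpan ℝ (b '' I), u ≠ 0 → 0 < hessian (energy b h ζ (s - 1)) v u u) ∧
      ∀ u ∈ (vectorSpan ℝ (b '' I))ᗮ, u ≠ 0 → hessian (energy b h ζ (s - 1)) v u u < 0 := by
  obtain ⟨T, hT, U, hU, hTU⟩ := mem_prod_iff.1
    ((eventually_spread_lt hh hζ hp hpos).and (eventually_lt_spread hp hpos))
  refine ⟨U, hU, ?_⟩
  filter_upwards [hT, eventually_gt_atTop 1] with s hs hs1 v hv hvU
  obtain ⟨h1, h2⟩ := hTU (mk_mem_prod hs hvU)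
  have h3 := fun u => hessian_energy_eq_spread hh hζ (s - 1) (v := v) (by rwa [sub_add_cancel]) u
  rw [sub_add_cancel] at h3
  have h4 : 0 < 2 * (s - 1) * ∑ j, ζ j * powerDist b h j v ^ (-s) :=
    mul_pos (by linarith) (sum_weightTerm_pos hζ hv.1)
  refine ⟨fun u hu hu0 => ?_, fun u hu hu0 => ?_⟩
  · rw [h3]
    exact mul_pos h4 (sub_pos.2 (h2 u hu hu0))
  · rw [h3]
    exact mul_neg_of_pos_of_neg h4 (sub_neg.2 (h1 v hv rfl u hu hu0))

end HessianSigns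

/-! ### The bijection with effective sets of minimizers, and directions of cells -/

section Correspondence

variable {E : Type*} [NormedAddCommGroup E] [InnerProductSpace ℝ E] [FiniteDimensional ℝ E]
  {ι : Type*} [Fintype ι] {b : ι → E} {h ζ : ι → ℝ}

/-- There are finitely many index sets, so their effective weights have disjoint neighborhoods and
the local statements hold for one common range of `s`. A balanced point is sent to the index set
whose neighborhood contains its weights. -/
theorem eventually_exists_equiv_balanced [Nonempty ι] (hh : ∀ i, 0 ≤ h i) (hζ : ∀ i, 0 < ζ i)
    (hgen : IsPowerGeneric b h) :
    ∀ᶠ s in atTop, ∃ Φ : balanced b h ζ s ≃ effectiveIndices b h, ∀ v : balanced b h ζ s,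
      (∀ u ∈ vectorSpan ℝ (b '' (Φ v : Set ι)), u ≠ 0 →
        0 < hessian (energy b h ζ (s - 1)) v u u) ∧
      ∀ u ∈ (vectorSpan ℝ (b '' (Φ v : Set ι)))ᗮ, u ≠ 0 →
        hessian (energy b h ζ (s - 1)) v u u < 0 := by
  have hP : ∀ I, ∃ p, I ∈ effectiveIndices b h → IsEffectiveWeight b h I p := by
    intro I
    by_cases hI : I ∈ effectiveIndices b h
    · obtain ⟨v, rfl, hv⟩ := hI.1
      obtain ⟨p, hp, -⟩ := exists_isEffectiveWeight hgen hv
      exact ⟨p, fun _ => hp⟩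
    · exact ⟨0, fun hc => absurd hc hI⟩
  choose P hP using hP
  have hind : ∀ I ∈ effectiveIndices b h, AffineIndependent ℝ fun i : I => b i := by
    intro I hI
    obtain ⟨v, rfl, -⟩ := hI.1
    exact (hgen v).1
  have hpos : ∀ I ∈ effectiveIndices b h, ∀ i, 0 < powerDist b h i (comb b (P I)) := fun I hI =>
    powerDist_pos_of_mem_effectiveIndices hh hI (hind I hI) (hP I hI).min
  have hPinj : InjOn P (effectiveIndices b h) := fun I hI J hJ hIJ => by
    rw [← (hP I hI).min, hIJ, (hP J hJ).min]
  obtain ⟨W, hW, hWd⟩ := (toFinite (P '' effectiveIndices b h)).t2_separation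
  have hU1 : ∀ I, ∃ U : Set (ι → ℝ), I ∈ effectiveIndices b h → U ∈ 𝓝 (P I) ∧
      ∀ᶠ s in atTop, ∀ v ∈ balanced b h ζ s, ∀ v' ∈ balanced b h ζ s,
        weight b h ζ s v ∈ U → weight b h ζ s v' ∈ U → v = v' := by
    intro I
    by_cases hI : I ∈ effectiveIndices b h
    · obtain ⟨U, hU⟩ :=
        (exists_nhds_existsUnique_balanced hζ (hP I hI) (hind I hI) (hpos I hI)).1
      exact ⟨U, fun _ => hU⟩
    · exact ⟨univ, fun hc => absurd hc hI⟩
  choose U1 hU1 using hU1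
  have hU2 : ∀ I, ∃ U : Set (ι → ℝ), I ∈ effectiveIndices b h → U ∈ 𝓝 (P I) ∧
      ∀ᶠ s in atTop, ∀ v ∈ balanced b h ζ s, weight b h ζ s v ∈ U →
        (∀ u ∈ vectorSpan ℝ (b '' I), u ≠ 0 → 0 < hessian (energy b h ζ (s - 1)) v u u) ∧
        ∀ u ∈ (vectorSpan ℝ (b '' I))ᗮ, u ≠ 0 → hessian (energy b h ζ (s - 1)) v u u < 0 := by
    intro I
    by_cases hI : I ∈ effectiveIndices b h
    · obtain ⟨U, hU⟩ := eventually_hessian_sign hh hζ (hP I hI) (hpos I hI)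
      exact ⟨U, fun _ => hU⟩
    · exact ⟨univ, fun hc => absurd hc hI⟩
  choose U2 hU2 using hU2
  let U : Set ι → Set (ι → ℝ) := fun I => U1 I ∩ U2 I ∩ W (P I)
  have hU : ∀ I ∈ effectiveIndices b h, U I ∈ 𝓝 (P I) := fun I hI =>
    inter_mem (inter_mem (hU1 I hI).1 (hU2 I hI).1) ((hW (P I)).2.mem_nhds (hW (P I)).1)
  have hdisj : ∀ I ∈ effectiveIndices b h, ∀ J ∈ effectiveIndices b h, ∀ p, p ∈ U I → p ∈ U J →
      I = J := by
    intro I hI J hJ p hpI hpJ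
    by_contra hne
    exact disjoint_left.1 (hWd (mem_image_of_mem P hI) (mem_image_of_mem P hJ)
      fun hc => hne (hPinj hI hJ hc)) hpI.2 hpJ.2
  have hloc := eventually_weight_mem (U := U) hh hζ hgen fun I hI p hp => by
    have : P I = p := eq_of_minimizers_comb_eq (hind I hI) (hP I hI).zero hp.zero (hP I hI).sum
      hp.sum (hP I hI).min hp.min
    exact this ▸ hU I hI
  have hex : ∀ᶠ s in atTop, ∀ I, I ∈ effectiveIndices b h →
      ∃ v ∈ balanced b h ζ s, weight b h ζ s v ∈ U I :=
    eventually_all.2 fun I => eventually_imp_distrib_left.2 fun hI =>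
      (exists_nhds_existsUnique_balanced hζ (hP I hI) (hind I hI) (hpos I hI)).2 _ (hU I hI)
  have huniq := eventually_all.2 fun I => eventually_imp_distrib_left.2 fun hI => (hU1 I hI).2
  have hsign := eventually_all.2 fun I => eventually_imp_distrib_left.2 fun hI => (hU2 I hI).2
  filter_upwards [hloc, hex, huniq, hsign] with s q1 q2 q3 q4
  choose φ hφ hφU using q1
  let f : balanced b h ζ s → effectiveIndices b h := fun v => ⟨φ v v.2, hφ v v.2⟩
  have hf : Function.Bijective f := by
    constructor
    · intro v v' hvv'
      have h1 : φ v v.2 = φ v' v'.2 := congrArg Subtype.val hvv'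
      have h2 := hφU v v.2
      rw [h1] at h2
      exact Subtype.ext (q3 _ (hφ v' v'.2) v v.2 v' v'.2 h2.1.1 (hφU v' v'.2).1.1)
    · rintro ⟨I, hI⟩
      obtain ⟨v, hv, hvU⟩ := q2 I hI
      exact ⟨⟨v, hv⟩, Subtype.ext (hdisj _ (hφ v hv) I hI _ (hφU v hv) hvU)⟩
  exact ⟨Equiv.ofBijective f hf, fun v => q4 _ (hφ v v.2) v v.2 (hφU v v.2).1.2⟩

/-- The critical points of the energy, off its singularities. -/
def energyCriticalPts (b : ι → E) (h ζ : ι → ℝ) (α : ℝ) : Set E :=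
  {v | (∀ i, 0 < powerDist b h i v) ∧ IsCriticalPt (energy b h ζ α) v}

theorem exists_equiv_energyCriticalPts_of_pos [Nonempty ι] (hh : ∀ i, 0 ≤ h i)
    (hζ : ∀ i, 0 < ζ i) (hgen : IsPowerGeneric b h) :
    ∃ α₀ : ℝ, 0 < α₀ ∧ ∀ α, α₀ ≤ α →
      ∃ Φ : energyCriticalPts b h ζ α ≃ effectiveIndices b h, ∀ v : energyCriticalPts b h ζ α,
        (∀ u ∈ vectorSpan ℝ (b '' (Φ v : Set ι)), u ≠ 0 →
          0 < hessian (energy b h ζ α) v u u) ∧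
        ∀ u ∈ (vectorSpan ℝ (b '' (Φ v : Set ι)))ᗮ, u ≠ 0 →
          hessian (energy b h ζ α) v u u < 0 := by
  obtain ⟨s₀, hs₀⟩ := eventually_atTop.1 (eventually_exists_equiv_balanced hh hζ hgen)
  refine ⟨max s₀ 1, by positivity, fun α hα => ?_⟩
  obtain ⟨Φ, hΦ⟩ := hs₀ (α + 1) (by linarith [le_max_left s₀ 1])
  rw [add_sub_cancel_right] at hΦ
  have hα0 : 0 < α := by linarith [le_max_right s₀ 1]
  have hset : energyCriticalPts b h ζ α = balanced b h ζ (α + 1) := by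
    ext v
    exact and_congr_right fun hv => isCriticalPt_energy_iff hh hα0 hζ hv
  exact ⟨(Equiv.setCongr hset).trans Φ, fun v => hΦ (Equiv.setCongr hset v)⟩

theorem energy_neg (b : ι → E) (h ζ : ι → ℝ) (α : ℝ) :
    energy b h (fun i => -ζ i) α = fun v => -energy b h ζ α v := by
  funext v
  simp [energy, neg_div]

theorem energyCriticalPts_neg (b : ι → E) (h ζ : ι → ℝ) (α : ℝ) :
    energyCriticalPts b h (fun i => -ζ i) α = energyCriticalPts b h ζ α := by
  ext v
  refine and_congr_right fun _ => ?_
  rw [energy_neg]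
  constructor
  · intro h1
    simpa [IsCriticalPt] using HasFDerivAt.fun_neg h1
  · intro h1
    simpa [IsCriticalPt] using HasFDerivAt.fun_neg h1

theorem hessian_energy_comm (hh : ∀ i, 0 ≤ h i) (ζ : ι → ℝ) (α : ℝ) {v : E}
    (hv : ∀ i, 0 < powerDist b h i v) (u u' : E) :
    hessian (energy b h ζ α) v u u' = hessian (energy b h ζ α) v u' u := by
  rw [hessian_energy hh ζ α hv, hessian_energy hh ζ α hv, real_inner_comm]
  congr 1
  exact Finset.sum_congr rfl fun i _ => by ring

/-- For large exponents, the critical points of the energy are nondegenerate and correspond to the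
effective sets of minimizers, which determine their Morse indices. -/
theorem exists_equiv_energyCriticalPts [Nonempty ι] (hh : ∀ i, 0 ≤ h i)
    (hζ : (∀ i, 0 < ζ i) ∨ ∀ i, ζ i < 0) (hgen : IsPowerGeneric b h) :
    ∃ α₀ : ℝ, 0 < α₀ ∧ ∀ α, α₀ ≤ α →
      ∃ Φ : energyCriticalPts b h ζ α ≃ effectiveIndices b h, ∀ v : energyCriticalPts b h ζ α,
        IsNondegenerateAt (energy b h ζ α) v ∧
        ((∀ i, 0 < ζ i) → morseIndex (energy b h ζ α) v =
          Module.finrank ℝ (vectorSpan ℝ (b '' (Φ v : Set ι)))ᗮ) ∧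
        ((∀ i, ζ i < 0) → morseIndex (energy b h ζ α) v =
          Module.finrank ℝ (vectorSpan ℝ (b '' (Φ v : Set ι)))) := by
  obtain ⟨i₀⟩ := ‹Nonempty ι›
  have : Nonempty ι := ⟨i₀⟩
  rcases hζ with hζ | hζ
  · obtain ⟨α₀, hα₀, hΦ⟩ := exists_equiv_energyCriticalPts_of_pos hh hζ hgen
    refine ⟨α₀, hα₀, fun α hα => ?_⟩
    obtain ⟨Φ, hΦ⟩ := hΦ α hα
    refine ⟨Φ, fun v => ⟨?_, fun _ => ?_, fun hc => absurd (hζ i₀) (hc i₀).not_gt⟩⟩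
    · exact isNondegenerateAt_of_isCompl (Submodule.isCompl_orthogonal _)
        (hessian_energy_comm hh ζ α v.2.1) (hΦ v).1 (hΦ v).2
    · exact morseIndex_eq_finrank (Submodule.isCompl_orthogonal _)
        (hΦ v).1 (hΦ v).2
  · obtain ⟨α₀, hα₀, hΦ⟩ := exists_equiv_energyCriticalPts_of_pos hh
      (fun i => neg_pos.2 (hζ i)) hgen
    refine ⟨α₀, hα₀, fun α hα => ?_⟩
    obtain ⟨Φ, hΦ⟩ := hΦ α hα
    let e := Equiv.setCongr (energyCriticalPts_neg b h ζ α)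
    refine ⟨e.symm.trans Φ, fun v => ?_⟩
    obtain ⟨h1, h2⟩ := hΦ (e.symm v)
    have h3 : ∀ u, hessian (energy b h (fun i => -ζ i) α) v u u =
        -hessian (energy b h ζ α) v u u := fun u => by
      rw [energy_neg, hessian_neg]
      rfl
    have h4 : ∀ u ∈ (vectorSpan ℝ (b '' (Φ (e.symm v) : Set ι)))ᗮ, u ≠ 0 →
        0 < hessian (energy b h ζ α) v u u := fun u hu hu0 =>
      neg_neg_iff_pos.1 ((h3 u).symm.trans_lt (h2 u hu hu0))
    have h5 : ∀ u ∈ vectorSpan ℝ (b '' (Φ (e.symm v) : Set ι)), u ≠ 0 →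
        hessian (energy b h ζ α) v u u < 0 := fun u hu hu0 =>
      neg_pos.1 ((h1 u hu hu0).trans_eq (h3 u))
    have hcompl := (Submodule.isCompl_orthogonal
      (K := vectorSpan ℝ (b '' (Φ (e.symm v) : Set ι)))).symm
    exact ⟨isNondegenerateAt_of_isCompl hcompl (hessian_energy_comm hh ζ α v.2.1) h4 h5,
      fun hc => absurd (hc i₀) (hζ i₀).not_gt, fun _ => morseIndex_eq_finrank hcompl h4 h5⟩

/-- Differences of power distances are affine, so moving inside a cell is moving orthogonally to
`b(I)`. Conversely, a small orthogonal move keeps the ties within `I` and the strict inequalities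
off `I`. -/
theorem vectorSpan_minimizers_eq [Nonempty ι] {I : Set ι}
    (hI : {v | minimizers b h v = I}.Nonempty) :
    vectorSpan ℝ {v | minimizers b h v = I} = (vectorSpan ℝ (b '' I))ᗮ := by
  apply le_antisymm
  · rw [vectorSpan, Submodule.span_le]
    rintro _ ⟨v, hv, v', hv', rfl⟩
    have hvv' : minimizers b h v = minimizers b h v' := Eq.trans hv (Eq.symm hv')
    refine mem_vectorSpan_orthogonal fun i hi j hj => ?_
    rw [real_inner_comm]
    rw [← show minimizers b h v = I from hv] at hi hj
    exact inner_sub_eq_zero_of_minimizers_eq hvv' hi hj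
  · intro w hw
    obtain ⟨v, hv⟩ := hI
    have hv' : minimizers b h v = I := hv
    obtain ⟨k, hk⟩ : I.Nonempty := hv' ▸ minimizers_nonempty b h v
    have hcont : ∀ i, Continuous fun t : ℝ => powerDist b h i (v + t • w) := fun i =>
      (continuous_powerDist b h i).comp (by fun_prop)
    have h1 : ∀ᶠ t in 𝓝 (0 : ℝ), ∀ j, j ∉ I →
        powerDist b h k (v + t • w) < powerDist b h j (v + t • w) := by
      refine eventually_all.2 fun j => eventually_imp_distrib_left.2 fun hj => ?_
      refine (hcont k).continuousAt.eventually_lt (hcont j).continuousAt ?_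
      simpa using powerDist_lt_of_notMem_minimizers (b := b) (h := h) (v := v)
        (by rwa [hv']) (by rwa [hv'])
    obtain ⟨t, h2, h3⟩ := ((h1.filter_mono nhdsWithin_le_nhds).and
      (self_mem_nhdsWithin : Ioi (0 : ℝ) ∈ 𝓝[>] 0)).exists
    have h4 : ∀ i ∈ I, powerDist b h i (v + t • w) = powerDist b h k (v + t • w) := by
      intro i hi
      have h5 := powerDist_sub_powerDist b h i k (v + t • w) v
      rw [add_sub_cancel_left, real_inner_smul_left, real_inner_comm,
        inner_eq_zero_of_mem_vectorSpan_orthogonal hw i hi k hk,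
        powerDist_eq_of_mem_minimizers (b := b) (h := h) (v := v) (i := i) (j := k)
          (by rwa [hv']) (by rwa [hv'])] at h5
      linarith
    have h6 : minimizers b h (v + t • w) = I := by
      ext i
      constructor
      · intro hi
        by_contra hiI
        exact (h2 i hiI).not_ge (hi k)
      · intro hi j
        rw [h4 i hi]
        by_cases hj : j ∈ I
        · rw [h4 j hj]
        · exact (h2 j hj).le
    have h7 : (v + t • w) -ᵥ v ∈ vectorSpan ℝ {v | minimizers b h v = I} :=
      vsub_mem_vectorSpan ℝ h6 hv
    rw [vsub_eq_sub, add_sub_cancel_left] at h7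
    exact (Submodule.smul_mem_iff _ (ne_of_gt h3)).1 h7

end Correspondence

/-! ### The whole space: zero heights -/

section Voronoi

variable {n : ℕ} {ι : Type*} [Fintype ι] {c : ι → Space n}

theorem powerDist_zero (c : ι → Space n) (i : ι) (x : Space n) :
    powerDist c 0 i x = dist x (c i) ^ 2 := by
  simp [powerDist, dist_eq_norm]

theorem minimizers_zero (c : ι → Space n) (x : Space n) : minimizers c 0 x = nearestSites c x := by
  ext i
  refine forall_congr' fun j => ?_
  rw [powerDist_zero, powerDist_zero, sq_le_sq₀ dist_nonneg dist_nonneg]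

theorem vectorSpan_voronoiCell [Nonempty ι] {I : Set ι} (hI : (voronoiCell c I).Nonempty) :
    vectorSpan ℝ (voronoiCell c I) = (vectorSpan ℝ (c '' I))ᗮ := by
  have h1 : voronoiCell c I = {x | minimizers c 0 x = I} := by
    ext x
    rw [mem_ofPred_eq, minimizers_zero]
    rfl
  rw [h1] at hI ⊢
  exact vectorSpan_minimizers_eq hI

theorem convexDim_voronoiCell_add [Nonempty ι] {I : Set ι} (hI : (voronoiCell c I).Nonempty) :
    Module.finrank ℝ (vectorSpan ℝ (c '' I)) + convexDim (voronoiCell c I) = n := by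
  rw [convexDim, vectorSpan_voronoiCell hI, Submodule.finrank_add_finrank_orthogonal,
    finrank_euclideanSpace_fin]

theorem convexCodim_voronoiCell [Nonempty ι] {I : Set ι} (hI : (voronoiCell c I).Nonempty) :
    convexCodim (voronoiCell c I) = Module.finrank ℝ (vectorSpan ℝ (c '' I)) := by
  have := convexDim_voronoiCell_add hI
  rw [convexCodim]
  omega

theorem affineIndependent_of_encard_eq {I : Set ι}
    (hI : I.encard = Module.finrank ℝ (vectorSpan ℝ (c '' I)) + 1) :
    AffineIndependent ℝ fun i : I => c i := by
  classical
  rw [affineIndependent_iff_finrank_vectorSpan_eq ℝ _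
    (n := Module.finrank ℝ (vectorSpan ℝ (c '' I))), image_eq_range]
  rw [← Nat.card_eq_fintype_card, Nat.card_coe_set_eq, ncard_def, hI]
  rfl

theorem nonempty_index_of_encard_eq {I : Set ι} {k : ℕ} (hI : I.encard = k + 1) : Nonempty ι := by
  have : I.Nonempty := by
    rw [← encard_ne_zero, hI]
    exact_mod_cast Nat.succ_ne_zero k
  exact ⟨this.some⟩

theorem one_lt_encard_iff_of_eq {I : Set ι} {k : ℕ} (hI : I.encard = k + 1) :
    1 < I.encard ↔ 0 < k := by
  rw [hI]
  norm_cast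
  omega

theorem nonempty_voronoiCell_nearestSites (c : ι → Space n) (x : Space n) :
    (voronoiCell c (nearestSites c x)).Nonempty := ⟨x, rfl⟩

theorem IsGeneric.nonempty_index (hgen : IsGeneric c) : Nonempty ι :=
  nonempty_index_of_encard_eq (hgen _ (nonempty_voronoiCell_nearestSites c 0)).1

theorem IsGeneric.isPowerGeneric (hgen : IsGeneric c) : IsPowerGeneric c 0 := by
  intro x
  have := hgen.nonempty_index
  have hx := nonempty_voronoiCell_nearestSites c x
  obtain ⟨h1, h2⟩ := hgen _ hx
  rw [minimizers_zero]
  refine ⟨affineIndependent_of_encard_eq ?_, fun hc => disjoint_left.1 h2 rfl hc⟩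
  rw [h1, convexCodim_voronoiCell hx]

/-- By genericity, positive codimension means more than one nearest site. The alternative of nonzero
heights never occurs, since `h = 0` and a set of minimizers is nonempty. -/
theorem IsGeneric.effectiveCells_eq (hgen : IsGeneric c) :
    effectiveCells c = effectiveIndices c 0 := by
  have := hgen.nonempty_index
  ext I
  simp only [effectiveCells, effectiveIndices, mem_ofPred_eq, minimizers_zero]
  constructor
  · rintro ⟨h1, h2, x, h3, h4⟩
    exact ⟨⟨x, h3, h4⟩, Or.inl ((one_lt_encard_iff_of_eq (hgen I h1).1).2 h2)⟩
  · rintro ⟨⟨x, rfl, h4⟩, h5⟩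
    have hx := nonempty_voronoiCell_nearestSites c x
    refine ⟨hx, ?_, x, rfl, h4⟩
    obtain ⟨i, hi⟩ := minimizers_nonempty c 0 x
    rw [minimizers_zero] at hi
    rcases h5 with h5 | h5
    · exact (one_lt_encard_iff_of_eq (hgen _ hx).1).1 h5
    · exact absurd rfl (h5 i hi)

theorem energy_zero (c : ι → Space n) (ζ : ι → ℝ) (α : ℝ) : energy c 0 ζ α = potential c ζ α := by
  funext x
  simp only [energy, potential, powerDist_zero]

theorem criticalPoints_eq (c : ι → Space n) (ζ : ι → ℝ) (α : ℝ) :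
    criticalPoints c ζ α = energyCriticalPts c 0 ζ α := by
  ext x
  rw [criticalPoints, energyCriticalPts, mem_ofPred_eq, mem_ofPred_eq, energy_zero]
  refine and_congr_left fun _ => forall_congr' fun i => ?_
  rw [powerDist_zero, sq_pos_iff, dist_ne_zero]

theorem exists_equiv_effectiveCells {ζ : ι → ℝ} (hζ : (∀ i, 0 < ζ i) ∨ ∀ i, ζ i < 0)
    (hgen : IsGeneric c) :
    ∃ α₀ : ℝ, 0 < α₀ ∧ ∀ α : ℝ, α₀ ≤ α →
      ∃ Φ : criticalPoints c ζ α ≃ effectiveCells c,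
        ∀ x : criticalPoints c ζ α,
          IsNondegenerateAt (potential c ζ α) (x : Space n) ∧
          ((∀ i, 0 < ζ i) →
            morseIndex (potential c ζ α) (x : Space n) =
              convexDim (voronoiCell c (Φ x : Set ι))) ∧
          ((∀ i, ζ i < 0) →
            morseIndex (potential c ζ α) (x : Space n) +
              convexDim (voronoiCell c (Φ x : Set ι)) = n) := by
  have := hgen.nonempty_index
  obtain ⟨α₀, hα₀, h1⟩ := exists_equiv_energyCriticalPts (b := c) (h := 0) (fun _ => le_rfl) hζ
    hgen.isPowerGeneric
  refine ⟨α₀, hα₀, fun α hα => ?_⟩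
  obtain ⟨Φ, hΦ⟩ := h1 α hα
  let e := Equiv.setCongr (criticalPoints_eq c ζ α)
  let e' := Equiv.setCongr hgen.effectiveCells_eq.symm
  refine ⟨(e.trans Φ).trans e', fun x => ?_⟩
  have hcell : (voronoiCell c (Φ (e x) : Set ι)).Nonempty := (e' (Φ (e x))).2.1
  obtain ⟨h2, h3, h4⟩ := hΦ (e x)
  rw [energy_zero] at h2 h3 h4
  refine ⟨h2, fun hp => (h3 hp).trans ?_, fun hn => ?_⟩
  · rw [← vectorSpan_voronoiCell hcell]
    rfl
  · rw [show morseIndex (potential c ζ α) (x : Space n) = _ from h4 hn]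
    exact convexDim_voronoiCell_add hcell

end Voronoi

/-! ### Restriction to an affine subspace -/

section Restriction

variable {n : ℕ} {ι : Type*} [Fintype ι] {c : ι → Space n} {L : AffineSubspace ℝ (Space n)}
  [Nonempty L]

/-- The parametrization of `L` by its direction, with origin `p`. -/
def chart (L : AffineSubspace ℝ (Space n)) [Nonempty L] (p : L) : L.direction →ᵃⁱ[ℝ] Space n :=
  L.subtypeₐᵢ.comp (AffineIsometryEquiv.vaddConst ℝ p).toAffineIsometry

/-- The projection of the sites to `L`, as vectors of the direction of `L`. -/
def projSite (c : ι → Space n) (L : AffineSubspace ℝ (Space n)) [Nonempty L] (p : L) (i : ι) :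
    L.direction :=
  EuclideanGeometry.orthogonalProjection L (c i) -ᵥ p

/-- The squared distance from the sites to `L`. -/
def siteHeight (c : ι → Space n) (L : AffineSubspace ℝ (Space n)) [Nonempty L] (i : ι) : ℝ :=
  dist (c i) (EuclideanGeometry.orthogonalProjection L (c i)) ^ 2

theorem chart_apply (p : L) (v : L.direction) : chart L p v = (v : Space n) + p := rfl

theorem chart_mem (p : L) (v : L.direction) : chart L p v ∈ L :=
  (v +ᵥ p : L).2

theorem exists_chart_eq (p : L) {x : Space n} (hx : x ∈ L) : ∃ v, chart L p v = x :=
  ⟨(⟨x, hx⟩ : L) -ᵥ p, by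
    rw [chart_apply]
    exact sub_add_cancel x (p : Space n)⟩

theorem chart_projSite (p : L) (i : ι) :
    chart L p (projSite c L p i) = EuclideanGeometry.orthogonalProjection L (c i) := by
  rw [chart_apply, projSite]
  exact sub_add_cancel _ (p : Space n)

theorem siteHeight_nonneg (i : ι) : 0 ≤ siteHeight c L i := sq_nonneg _

theorem siteHeight_ne_zero_iff (i : ι) : siteHeight c L i ≠ 0 ↔ c i ∉ L := by
  rw [siteHeight, Ne, pow_eq_zero_iff two_ne_zero,
    EuclideanGeometry.dist_orthogonalProjection_eq_zero_iff]

/-- Pythagoras at the foot of the perpendicular from the site to `L`. -/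
theorem powerDist_projSite (p : L) (i : ι) (v : L.direction) :
    powerDist (projSite c L p) (siteHeight c L) i v = dist (chart L p v) (c i) ^ 2 := by
  rw [sq (dist _ _),
    EuclideanGeometry.dist_sq_eq_dist_orthogonalProjection_sq_add_dist_orthogonalProjection_sq
      (c i) (chart_mem p v), ← chart_projSite p i, (chart L p).dist_map, powerDist, siteHeight,
    ← chart_projSite p i, ← sq, ← sq, dist_eq_norm v]

theorem minimizers_projSite (p : L) (v : L.direction) :
    minimizers (projSite c L p) (siteHeight c L) v = nearestSites c (chart L p v) := by
  ext i
  refine forall_congr' fun j => ?_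
  rw [powerDist_projSite, powerDist_projSite, sq_le_sq₀ dist_nonneg dist_nonneg]

theorem image_chart_projSite (p : L) (I : Set ι) :
    chart L p '' (projSite c L p '' I) = projectedSites c L I := by
  rw [image_image, projectedSites]
  exact image_congr fun i _ => chart_projSite p i

theorem image_chart_convexHull (p : L) (I : Set ι) :
    chart L p '' convexHull ℝ (projSite c L p '' I) = convexHull ℝ (projectedSites c L I) := by
  rw [← image_chart_projSite p I]
  exact AffineMap.image_convexHull (chart L p).toAffineMap _

theorem mem_projSite_convexHull_iff (p : L) (I : Set ι) (v : L.direction) :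
    v ∈ convexHull ℝ (projSite c L p '' I) ↔
      chart L p v ∈ convexHull ℝ (projectedSites c L I) := by
  rw [← image_chart_convexHull p, (chart L p).injective.mem_set_image]

theorem image_chart_minimizers (p : L) (I : Set ι) :
    chart L p '' {v | minimizers (projSite c L p) (siteHeight c L) v = I} =
      voronoiCell c I ∩ L := by
  ext x
  constructor
  · rintro ⟨v, hv, rfl⟩
    rw [mem_ofPred_eq, minimizers_projSite] at hv
    exact ⟨hv, chart_mem p v⟩
  · rintro ⟨hx, hxL⟩
    obtain ⟨v, rfl⟩ := exists_chart_eq p hxL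
    refine ⟨v, ?_, rfl⟩
    rw [mem_ofPred_eq, minimizers_projSite]
    exact hx

theorem convexDim_image_chart (p : L) (S : Set L.direction) :
    convexDim (chart L p '' S) = Module.finrank ℝ (vectorSpan ℝ S) := by
  have h1 : vectorSpan ℝ (chart L p '' S) =
      (vectorSpan ℝ S).map (chart L p).toAffineMap.linear :=
    ((chart L p).toAffineMap.map_vectorSpan (s := S)).symm
  rw [convexDim, h1]
  exact (Submodule.equivMapOfInjective (chart L p).toAffineMap.linear
    (chart L p).linearIsometry.injective (vectorSpan ℝ S)).finrank_eq.symm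

theorem convexDim_voronoiCell_inter [Nonempty ι] (p : L) {I : Set ι}
    (hI : (voronoiCell c I ∩ (L : Set (Space n))).Nonempty) :
    convexDim (voronoiCell c I ∩ (L : Set (Space n))) =
      Module.finrank ℝ (vectorSpan ℝ (projSite c L p '' I))ᗮ := by
  rw [← image_chart_minimizers p, convexDim_image_chart, vectorSpan_minimizers_eq]
  rw [← image_chart_minimizers p] at hI
  exact hI.of_image

theorem inner_projSite (p : L) (i : ι) (u : L.direction) :
    inner ℝ (projSite c L p i) u = inner ℝ (c i - p) (u : Space n) := by
  have h1 := EuclideanGeometry.vsub_orthogonalProjection_mem_direction_orthogonal L (c i)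
  have h2 : inner ℝ (c i - EuclideanGeometry.orthogonalProjection L (c i)) (u : Space n) = 0 := by
    rw [real_inner_comm]
    exact h1 u u.2
  have h3 : c i - (p : Space n) = (c i - EuclideanGeometry.orthogonalProjection L (c i)) +
      (projSite c L p i : Space n) := by
    have h4 := chart_projSite (c := c) p i
    rw [chart_apply] at h4
    rw [← h4]
    abel
  rw [h3, inner_add_left, h2, zero_add]
  rfl

/-- Transversality to `L` of the orthogonal complement of the affine span of affinely independent
sites keeps their projections to `L` affinely independent. -/
theorem affineIndependent_projSite (p : L) {I : Set ι}
    (hind : AffineIndependent ℝ fun i : I => c i)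
    (htrans : (vectorSpan ℝ (c '' I))ᗮ ⊔ L.direction = ⊤) :
    AffineIndependent ℝ fun i : I => projSite c L p i := by
  rw [affineIndependent_iff]
  intro s w hw hsum
  refine affineIndependent_iff.1 hind s w hw ?_
  -- A dependence of the projections makes `y` orthogonal to the direction of `L`; as the
  -- coefficients sum to zero, `y` is also orthogonal to the direction of the cell. By
  -- transversality the two span everything.
  set y := ∑ e ∈ s, w e • c e with hy
  have h1 : ∀ u ∈ (vectorSpan ℝ (c '' I))ᗮ, inner ℝ y u = 0 := by
    intro u hu
    have h2 : ∀ i ∈ I, ∀ j ∈ I, inner ℝ (c i) u = inner ℝ (c j) u := fun i hi j hj => by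
      rw [← sub_eq_zero, ← inner_sub_left]
      exact inner_eq_zero_of_mem_vectorSpan_orthogonal hu i hi j hj
    rw [hy, sum_inner]
    rcases s.eq_empty_or_nonempty with rfl | ⟨e₀, -⟩
    · simp
    · calc _ = ∑ e ∈ s, w e * inner ℝ (c e₀) u := Finset.sum_congr rfl fun e _ => by
            rw [real_inner_smul_left, h2 e e.2 e₀ e₀.2]
        _ = 0 := by rw [← Finset.sum_mul, hw, zero_mul]
  have h3 : ∀ u ∈ L.direction, inner ℝ y u = 0 := by
    intro u hu
    have h4 := congrArg (fun z => inner ℝ z (⟨u, hu⟩ : L.direction)) hsum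
    simp only [sum_inner, real_inner_smul_left, inner_projSite, inner_zero_left, inner_sub_left,
      mul_sub, Finset.sum_sub_distrib, ← Finset.sum_mul, hw, zero_mul, sub_zero] at h4
    rw [hy, sum_inner, ← h4]
    exact Finset.sum_congr rfl fun e _ => real_inner_smul_left _ _ _
  have hy_mem : y ∈ (vectorSpan ℝ (c '' I))ᗮ ⊔ L.direction := htrans ▸ Submodule.mem_top
  obtain ⟨a, ha, d, hd, had⟩ := Submodule.mem_sup.1 hy_mem
  rw [← inner_self_eq_zero (𝕜 := ℝ)]
  nth_rewrite 2 [← had]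
  rw [inner_add_right, h1 a ha, h3 d hd, add_zero]

theorem nonempty_voronoiCell_inter (c : ι → Space n) (p : L) (v : L.direction) :
    (voronoiCell c (nearestSites c (chart L p v)) ∩ (L : Set (Space n))).Nonempty :=
  ⟨chart L p v, rfl, chart_mem p v⟩

theorem MeetsGenerically.nonempty_index (hgen : MeetsGenerically c L) : Nonempty ι :=
  nonempty_index_of_encard_eq
    (hgen _ (nonempty_voronoiCell_inter c (Classical.arbitrary L) 0)).2.1

theorem MeetsGenerically.isPowerGeneric (hgen : MeetsGenerically c L) (p : L) :
    IsPowerGeneric (projSite c L p) (siteHeight c L) := by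
  intro v
  have := hgen.nonempty_index
  have hx := nonempty_voronoiCell_inter c p v
  obtain ⟨h1, h2, h3⟩ := hgen _ hx
  have hcell := hx.mono inter_subset_left
  rw [minimizers_projSite]
  rw [vectorSpan_voronoiCell hcell] at h1
  rw [convexCodim_voronoiCell hcell] at h2
  refine ⟨affineIndependent_projSite p (affineIndependent_of_encard_eq h2) h1, fun hc => ?_⟩
  rw [← image_chart_convexHull p, AffineIsometry.intrinsicFrontier_image] at h3
  exact disjoint_left.1 h3 rfl (mem_image_of_mem _ hc)

/-- The hull of the projected sites lies in `L`, so a cell effective with respect to `L` meets `L`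
and the genericity assumption applies to it. -/
theorem MeetsGenerically.effectiveCellsOn_eq (hgen : MeetsGenerically c L) (p : L) :
    effectiveCellsOn c L = effectiveIndices (projSite c L p) (siteHeight c L) := by
  ext I
  simp only [effectiveCellsOn, effectiveIndices, mem_ofPred_eq, minimizers_projSite,
    siteHeight_ne_zero_iff, mem_projSite_convexHull_iff]
  constructor
  · rintro ⟨h1, h2, x, h3, h4⟩
    have hx := h4
    rw [← image_chart_convexHull p] at hx
    obtain ⟨v, -, rfl⟩ := hx
    refine ⟨⟨v, h3, h4⟩, h2.imp_left fun h5 => ?_⟩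
    exact (one_lt_encard_iff_of_eq (hgen I ⟨_, h3, chart_mem p v⟩).2.1).2 h5
  · rintro ⟨⟨v, rfl, h4⟩, h5⟩
    have hx := nonempty_voronoiCell_inter c p v
    refine ⟨hx.mono inter_subset_left, h5.imp_left fun h6 => ?_, _, rfl, h4⟩
    exact (one_lt_encard_iff_of_eq (hgen _ hx).2.1).1 h6

theorem potential_chart (ζ : ι → ℝ) (α : ℝ) (p : L) (v : L.direction) :
    potential c ζ α (chart L p v) = energy (projSite c L p) (siteHeight c L) ζ α v := by
  simp only [energy, potential, powerDist_projSite]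

theorem restrictAt_chart (ζ : ι → ℝ) (α : ℝ) (p : L) (v : L.direction) :
    restrictAt (potential c ζ α) L (chart L p v) =
      fun w => energy (projSite c L p) (siteHeight c L) ζ α (v + w) := by
  funext w
  rw [restrictAt, ← potential_chart]
  congr 1
  simp only [chart_apply, Submodule.coe_add]
  abel

theorem image_chart_energyCriticalPts (ζ : ι → ℝ) (α : ℝ) (p : L) :
    chart L p '' energyCriticalPts (projSite c L p) (siteHeight c L) ζ α =
      criticalPointsOn c ζ α L := by
  have key : ∀ v : L.direction, v ∈ energyCriticalPts (projSite c L p) (siteHeight c L) ζ α ↔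
      chart L p v ∈ criticalPointsOn c ζ α L := by
    intro v
    rw [energyCriticalPts, criticalPointsOn, mem_ofPred_eq, mem_ofPred_eq, restrictAt_chart,
      isCriticalPt_comp_add_left, add_zero, and_iff_right (chart_mem p v)]
    refine and_congr_left fun _ => forall_congr' fun i => ?_
    rw [powerDist_projSite, sq_pos_iff, dist_ne_zero]
  ext x
  constructor
  · rintro ⟨v, hv, rfl⟩
    exact (key v).1 hv
  · intro hx
    obtain ⟨v, rfl⟩ := exists_chart_eq p hx.1
    exact ⟨v, (key v).2 hx, rfl⟩

theorem exists_equiv_effectiveCellsOn {ζ : ι → ℝ} (hζ : (∀ i, 0 < ζ i) ∨ ∀ i, ζ i < 0)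
    (hgen : MeetsGenerically c L) :
    ∃ α₀ : ℝ, 0 < α₀ ∧ ∀ α : ℝ, α₀ ≤ α →
      ∃ Φ : criticalPointsOn c ζ α L ≃ effectiveCellsOn c L,
        ∀ x : criticalPointsOn c ζ α L,
          IsNondegenerateAt (restrictAt (potential c ζ α) L (x : Space n)) 0 ∧
          ((∀ i, 0 < ζ i) →
            morseIndex (restrictAt (potential c ζ α) L (x : Space n)) 0 =
              convexDim (voronoiCell c (Φ x : Set ι) ∩ (L : Set (Space n)))) ∧
          ((∀ i, ζ i < 0) →
            morseIndex (restrictAt (potential c ζ α) L (x : Space n)) 0 +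
              convexDim (voronoiCell c (Φ x : Set ι) ∩ (L : Set (Space n))) =
                Module.finrank ℝ L.direction) := by
  have := hgen.nonempty_index
  let p : L := Classical.arbitrary L
  obtain ⟨α₀, hα₀, h1⟩ := exists_equiv_energyCriticalPts (b := projSite c L p)
    (h := siteHeight c L) siteHeight_nonneg hζ (hgen.isPowerGeneric p)
  refine ⟨α₀, hα₀, fun α hα => ?_⟩
  obtain ⟨Φ, hΦ⟩ := h1 α hα
  let e : energyCriticalPts (projSite c L p) (siteHeight c L) ζ α ≃ criticalPointsOn c ζ α L :=
    (Equiv.Set.image _ _ (chart L p).injective).trans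
      (Equiv.setCongr (image_chart_energyCriticalPts ζ α p))
  let e' := Equiv.setCongr (hgen.effectiveCellsOn_eq p).symm
  refine ⟨(e.symm.trans Φ).trans e', fun x => ?_⟩
  obtain ⟨v, rfl⟩ := e.surjective x
  have hv : ((e v : criticalPointsOn c ζ α L) : Space n) = chart L p v := rfl
  have hΦv : ((((e.symm.trans Φ).trans e') (e v) : effectiveCellsOn c L) : Set ι) = Φ v := by
    simp only [Equiv.trans_apply, Equiv.symm_apply_apply]
    rfl
  obtain ⟨h2, h3, h4⟩ := hΦ v
  have hcell : (voronoiCell c (Φ v : Set ι) ∩ (L : Set (Space n))).Nonempty := by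
    obtain ⟨⟨w, hw, -⟩, -⟩ := (Φ v).2
    rw [← hw, minimizers_projSite]
    exact nonempty_voronoiCell_inter c p w
  have hhess : hessian (restrictAt (potential c ζ α) L (chart L p v)) 0 =
      hessian (energy (projSite c L p) (siteHeight c L) ζ α) v := by
    rw [restrictAt_chart, hessian_comp_add_left, add_zero]
  have hmorse : morseIndex (restrictAt (potential c ζ α) L (chart L p v)) 0 =
      morseIndex (energy (projSite c L p) (siteHeight c L) ζ α) v := by
    rw [morseIndex, morseIndex, hhess]
  rw [hv, hΦv, hmorse, convexDim_voronoiCell_inter p hcell, IsNondegenerateAt, hhess]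
  refine ⟨h2, h3, fun hn => ?_⟩
  rw [h4 hn, Submodule.finrank_add_finrank_orthogonal]

end Restriction

end PointCharges

end

theorem theorem3 {n : ℕ} {ι : Type*} [Fintype ι] (c : ι → Space n)
    (hc : Function.Injective c) (ζ : ι → ℝ)
    (hζ : (∀ i, 0 < ζ i) ∨ (∀ i, ζ i < 0)) :
    (IsGeneric c →
      ∃ α₀ : ℝ, 0 < α₀ ∧ ∀ α : ℝ, α₀ ≤ α →
        ∃ Φ : criticalPoints c ζ α ≃ effectiveCells c,
          ∀ x : criticalPoints c ζ α,
            IsNondegenerateAt (potential c ζ α) (x : Space n) ∧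
            ((∀ i, 0 < ζ i) →
              morseIndex (potential c ζ α) (x : Space n) =
                convexDim (voronoiCell c (Φ x : Set ι))) ∧
            ((∀ i, ζ i < 0) →
              morseIndex (potential c ζ α) (x : Space n) +
                convexDim (voronoiCell c (Φ x : Set ι)) = n)) ∧
    (∀ (L : AffineSubspace ℝ (Space n)) [Nonempty L], MeetsGenerically c L →
      ∃ α₀ : ℝ, 0 < α₀ ∧ ∀ α : ℝ, α₀ ≤ α →
        ∃ Φ : criticalPointsOn c ζ α L ≃ effectiveCellsOn c L,
          ∀ x : criticalPointsOn c ζ α L,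
            IsNondegenerateAt (restrictAt (potential c ζ α) L (x : Space n)) 0 ∧
            ((∀ i, 0 < ζ i) →
              morseIndex (restrictAt (potential c ζ α) L (x : Space n)) 0 =
                convexDim (voronoiCell c (Φ x : Set ι) ∩ (L : Set (Space n)))) ∧
            ((∀ i, ζ i < 0) →
              morseIndex (restrictAt (potential c ζ α) L (x : Space n)) 0 +
                convexDim (voronoiCell c (Φ x : Set ι) ∩ (L : Set (Space n))) =
                  Module.finrank ℝ L.direction)) :=
  ⟨exists_equiv_effectiveCells hζ, fun _ _ => exists_equiv_effectiveCellsOn hζ⟩
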